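/- There is a constant $K$ such that the following holds for all integers $n \ge 2$ and all non-empty sets $L \subseteq \{0,\dots,n-1\}^2$ such that any two distinct points $(x,y),(x',y') \in L$ satisfy $|x-x'| \ge \lceil \log_2 n\rceil$ or $|y-y'| \ge \lceil \log_2 n\rceil$. There is a tile-assembly system $\mathcal T=(T,\sigma,2)$ in the two-dimensional abstract Tile-Assembly Model (aTAM) at temperature $2$, with a seed $\sigma$ that consists of a single tile, with $|T| \le K\,|L|\log_2 n$ tile types, and with a colour assigned to each tile type, such that $\mathcal T$ weakly self-assembles the $n \times n$ pattern on $\{0,\dots,n-1\}^2$ that is black at the points of $L$ and white at all other points. Here a tile type is a unit square with a glue (a label and a strength in $\mathbb N$, with a single glue of strength $0$) on each of its four sides. Adjacent tiles are bound, with the strength of their common glue, if the glues on their abutting sides are equal and of positive strength. An assembly is a partial map $\mathbb Z^2 \dashrightarrow T$ with non-empty connected domain. It is $\tau$-stable if every cut of the weighted graph of its bonds has weight at least $\tau$. Starting from $\sigma$, tiles are added one at a time, finitely or infinitely often, such that each assembly of the sequence is $2$-stable. The last assembly of such a sequence, or the union of its assemblies if it is infinite, is producible, and a producible assembly is terminal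 if it is $2$-stable and no tile can be added to it so that the result is $2$-stable. "Weakly self-assembles" means that in every producible terminal assembly the set of locations of black or white tiles is exactly $\{0,\dots,n-1\}^2$, and each of these tiles has the colour that the pattern prescribes. The colours are taken from an arbitrary set that contains black and white; in particular black and white alone suffice. -/

import Mathlib

/-! The two-dimensional abstract Tile-Assembly Model (aTAM) and self-assembly of coloured
patterns. -/

namespace ATAM

open Classical

/-- A location of the lattice `ℤ²`. -/
abbrev Point : Type := ℤ × ℤ

/-- The four sides of a tile. -/
inductive Dir : Type
  | north
  | east
  | south
  | west

/-- The unit vector that points out of the given side. -/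
def Dir.vec : Dir → Point
  | .north => (0, 1)
  | .east => (1, 0)
  | .south => (0, -1)
  | .west => (-1, 0)

/-- The side of the neighbouring tile that abuts the given side. -/
def Dir.opp : Dir → Dir
  | .north => .south
  | .east => .west
  | .south => .north
  | .west => .east

/-- A glue: a label (a finite string over the binary alphabet) together with a strength.
There is only one glue of strength `0`, the null glue; its label is the empty string. -/
@[ext]
structure Glue : Type where
  label : List Bool
  strength : ℕ
  null_label : strength = 0 → label = []

/-- A tile type: a unit square with a glue on each of its four sides. -/
abbrev TileType : Type := Dir → Glue

/-- A configuration over the tile set `T`: a partial function from `ℤ²` to `T`. -/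
abbrev Configuration (T : Finset TileType) : Type := Point → Option T

variable {T : Finset TileType}

/-- The set of locations that carry a tile. -/
def shape (α : Configuration T) : Set Point := {p | α p ≠ none}

/-- The grid graph on `ℤ²`: locations at distance one are adjacent. -/
def latticeGraph : SimpleGraph Point where
  Adj p q := |p.1 - q.1| + |p.2 - q.2| = 1
  symm := ⟨fun p q h => by rw [abs_sub_comm q.1, abs_sub_comm q.2]; exact h⟩
  loopless := ⟨fun p h => by simp at h⟩

/-- An assembly is a configuration whose domain is connected and non-empty. -/
def IsAssembly (α : Configuration T) : Prop := (latticeGraph.induce (shape α)).Connected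

/-- The weight of the edge of the binding graph between `p` and its neighbour in direction `d`:
the strength of the common glue if both locations are occupied and the glues on the abutting sides
are equal, and `0` (no edge) otherwise. -/
noncomputable def bond (α : Configuration T) (p : Point) (d : Dir) : ℕ :=
  match α p, α (p + d.vec) with
  | some s, some t => if s.1 d = t.1 d.opp then (s.1 d).strength else 0
  | _, _ => 0

/-- An assembly is `τ`-stable if every cut of its binding graph has weight at least `τ`. A cut is
given by one of its two sides `A`. A pair `(p, d)` with `p` in `A` and the neighbour of `p` in
direction `d` on the other side describes an edge across the cut, each such edge exactly once.
As the assembly may be infinite, "the total weight is at least `τ`" is expressed by a finite set of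
crossing edges of total weight at least `τ`. -/
def IsStable (τ : ℕ) (α : Configuration T) : Prop :=
  IsAssembly α ∧
    ∀ A ⊆ shape α, A.Nonempty → (shape α \ A).Nonempty →
      ∃ F : Finset (Point × Dir),
        (∀ e ∈ F, e.1 ∈ A ∧ e.1 + e.2.vec ∈ shape α \ A) ∧
          τ ≤ ∑ e ∈ F, bond α e.1 e.2

/-- `α ⊑ β`: the configuration `β` has the tiles of `α` in all locations of `α`. -/
def IsSubassembly (α β : Configuration T) : Prop := ∀ p ∈ shape α, β p = α p

/-- A tile-assembly system. -/
structure TAS : Type where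
  /-- the tile set -/
  tiles : Finset TileType
  /-- the seed assembly -/
  seed : Configuration tiles
  /-- the binding threshold, or temperature -/
  temp : ℕ
  temp_pos : 0 < temp
  seed_finite : (shape seed).Finite
  seed_stable : IsStable temp seed

/-- The seed consists of a single tile. -/
def TAS.SinglySeeded (S : TAS) : Prop := (shape S.seed).encard = 1

/-- `α` produces `β` in one step: both are stable, and `β` is `α` with one tile added. -/
def TAS.Step (S : TAS) (α β : Configuration S.tiles) : Prop :=
  IsStable S.temp α ∧ IsStable S.temp β ∧ IsSubassembly α β ∧ (shape β \ shape α).encard = 1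

/-- `α` produces `β`: there is an assembly sequence that starts with `α` and has result `β`. The
result of a finite sequence is its last assembly; the result of an infinite sequence consists of
all the tiles of all its assemblies. -/
def TAS.Produces (S : TAS) (α β : Configuration S.tiles) : Prop :=
  Relation.ReflTransGen S.Step α β ∨
    ∃ s : ℕ → Configuration S.tiles, s 0 = α ∧ (∀ i, S.Step (s i) (s (i + 1))) ∧
      ∀ p t, β p = some t ↔ ∃ i, s i p = some t

/-- The assemblies that the system produces from its seed. -/
def TAS.producible (S : TAS) : Set (Configuration S.tiles) := {α | S.Produces S.seed α}

/-- The producible assemblies that are terminal: they are stable and no tile can be added. -/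
def TAS.terminal (S : TAS) : Set (Configuration S.tiles) :=
  {α | α ∈ S.producible ∧ IsStable S.temp α ∧ ∀ β, ¬ S.Step α β}

variable {C : Type*}

/-- A pattern: a set of locations with colours. -/
abbrev Pattern (C : Type*) : Type _ := Set (Point × C)

/-- The set of locations to which a pattern assigns a colour. -/
def Pattern.dom (P : Pattern C) : Set Point := {p | ∃ c, (p, c) ∈ P}

/-- The colour of the tile of `α` at `p`, undefined if there is no tile. -/
def colorAt (color : T → C) (α : Configuration T) (p : Point) : Option C := (α p).map color

/-- The set of locations of the tiles of `α` whose colour lies in `D`. -/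
def colorDom (color : T → C) (D : Set C) (α : Configuration T) : Set Point :=
  {p | ∃ c ∈ D, colorAt color α p = some c}

/-- The system `S`, with tile types coloured by `color`, weakly self-assembles the pattern `P`,
whose colours are the set `D`: in every terminal assembly the tiles with colours in `D` occupy
exactly the domain of `P`, and they have the colours that `P` prescribes. -/
def TAS.WeaklySelfAssembles (S : TAS) (color : S.tiles → C) (D : Set C) (P : Pattern C) : Prop :=
  ∀ α ∈ S.terminal, colorDom color D α = P.dom ∧ ∀ p c, (p, c) ∈ P → colorAt color α p = some c

/-- The `n × n` square `{0, …, n - 1}²`. -/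
def square (n : ℕ) : Set Point := {p | 0 ≤ p.1 ∧ p.1 < n ∧ 0 ≤ p.2 ∧ p.2 < n}

/-- The pattern on the `n × n` square that is black on `L` and white elsewhere. -/
noncomputable def multiPixel (black white : C) (n : ℕ) (L : Finset Point) : Pattern C :=
  {q | q.1 ∈ square n ∧ q.2 = if q.1 ∈ L then black else white}

end ATAM

/-!
The tiles form a comb: a vertical spine of width `h ≈ log₂ n` along the west side, and horizontal
teeth, of heights between `h` and `2 * h`, in the slabs that contain pixels. Each strip of the comb
is grown two lines at a time. A pair of lines that contains a pixel or the start of a tooth, or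
that begins or ends its strip, is hard-coded, with a tile type for each location; there are
`O(|L|)` such pairs, with `O(log n)` tiles each. In between, a binary counter of `h` digits is
incremented once in each pair of lines: the first line adds with carry from the low to the high
end, the second one copies the result back together with an overflow flag. The counter starts with
the value that makes it overflow exactly at the next hard-coded pair, which it enters at a location
that the tiles at the low end remember; so there are `O(|L|)` types of low-end tiles, while `O(1)`
types of counter tiles suffice for the other digits. A single tile type, bound by two glues of
strength 1, fills the rest of the square.

The assembly is unique because it is locally deterministic: the inputs of each tile have total
weight exactly 2, the temperature, and any neighbours that offer a tile inputs of that weight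
determine it.
-/

namespace ATAM

open Classical

noncomputable instance : Fintype Dir where
  elems := {.north, .east, .south, .west}
  complete d := by cases d <;> simp

@[simp]
theorem Dir.opp_opp (d : Dir) : d.opp.opp = d := by cases d <;> rfl

@[simp]
theorem Dir.add_vec_add_opp_vec (p : Point) (d : Dir) : p + d.vec + d.opp.vec = p := by
  cases d <;> simp [Dir.vec, Dir.opp, add_assoc]

@[simp]
theorem Dir.vec_ne_zero (d : Dir) : d.vec ≠ 0 := by
  cases d <;> simp [Dir.vec]

theorem latticeGraph_adj_add_vec (p : Point) (d : Dir) : latticeGraph.Adj p (p + d.vec) := by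
  cases d <;> simp [latticeGraph, Dir.vec]

section Stability

variable {T : Finset TileType} {α β : Configuration T} {p q : Point} {d : Dir} {t : T} {τ : ℕ}

theorem mem_shape : p ∈ shape α ↔ ∃ t, α p = some t := by
  simp [shape, Option.ne_none_iff_exists']

theorem shape_update (α : Configuration T) (p : Point) (t : T) :
    shape (Function.update α p (some t)) = insert p (shape α) := by
  ext q
  by_cases h : q = p <;> simp [shape, h]

theorem bond_of_eq_some {s t : T} (hs : α p = some s) (ht : α (p + d.vec) = some t) :
    bond α p d = if s.1 d = t.1 d.opp then (s.1 d).strength else 0 := by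
  simp [bond, hs, ht]

theorem bond_opp (α : Configuration T) (p : Point) (d : Dir) :
    bond α (p + d.vec) d.opp = bond α p d := by
  unfold bond
  rw [Dir.add_vec_add_opp_vec, Dir.opp_opp]
  cases α p <;> cases α (p + d.vec) <;> simp only
  split_ifs with h1 h2 h2 <;> simp_all

theorem bond_congr (h : β p = α p) (h' : β (p + d.vec) = α (p + d.vec)) :
    bond β p d = bond α p d := by
  simp [bond, h, h']

theorem add_vec_mem_shape_of_bond_ne_zero (h : bond α p d ≠ 0) : p + d.vec ∈ shape α := by
  contrapose! h
  have hnone : α (p + d.vec) = none := by simpa [shape] using h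
  simp [bond, hnone]

/-- The edges of the binding graph that lead from `A` to `B` have total weight at least `τ`. For
infinite assemblies this means that finitely many of them do. -/
def BondsAtLeast (τ : ℕ) (α : Configuration T) (A B : Set Point) : Prop :=
  ∃ F : Finset (Point × Dir), (∀ e ∈ F, e.1 ∈ A ∧ e.1 + e.2.vec ∈ B) ∧
    τ ≤ ∑ e ∈ F, bond α e.1 e.2

namespace BondsAtLeast

variable {A B : Set Point}

theorem symm (h : BondsAtLeast τ α A B) : BondsAtLeast τ α B A := by
  obtain ⟨F, hF, hτ⟩ := h
  have hinj : Function.Injective fun e : Point × Dir => (e.1 + e.2.vec, e.2.opp) :=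
    Function.LeftInverse.injective (g := fun e : Point × Dir => (e.1 + e.2.vec, e.2.opp))
      fun e => by simp
  refine ⟨F.map ⟨_, hinj⟩, ?_, ?_⟩
  · rw [Finset.forall_mem_map]
    exact fun e he => ⟨(hF e he).2, by simpa using (hF e he).1⟩
  · simpa [bond_opp] using hτ

theorem congr_mono {A' B' : Set Point} (h : BondsAtLeast τ α A B) (hA : ∀ p ∈ A, β p = α p)
    (hB : ∀ p ∈ B, β p = α p) (hAA' : A ⊆ A') (hBB' : B ⊆ B') : BondsAtLeast τ β A' B' := by
  obtain ⟨F, hF, hτ⟩ := h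
  refine ⟨F, fun e he => ⟨hAA' (hF e he).1, hBB' (hF e he).2⟩, hτ.trans_eq ?_⟩
  exact Finset.sum_congr rfl fun e he => (bond_congr (hA _ (hF e he).1) (hB _ (hF e he).2)).symm

end BondsAtLeast

theorem bondsAtLeast_singleton_iff :
    BondsAtLeast τ α {p} (shape α \ {p}) ↔ τ ≤ ∑ d, bond α p d := by
  constructor
  · rintro ⟨F, hF, hτ⟩
    have hFp : ∀ e ∈ F, e.1 = p := fun e he => (hF e he).1
    calc τ ≤ ∑ e ∈ F, bond α e.1 e.2 := hτ
      _ = ∑ e ∈ F, bond α p e.2 := Finset.sum_congr rfl fun e he => by rw [hFp e he]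
      _ = ∑ d ∈ F.image Prod.snd, bond α p d :=
        (Finset.sum_image fun e he e' he' h =>
          Prod.ext ((hFp e he).trans (hFp e' he').symm) h).symm
      _ ≤ ∑ d, bond α p d := Finset.sum_le_sum_of_subset (Finset.subset_univ _)
  · intro hτ
    refine ⟨{e ∈ (Finset.univ : Finset Dir).map ⟨Prod.mk p, Prod.mk_right_injective p⟩ |
      bond α e.1 e.2 ≠ 0},
      ?_, ?_⟩
    · simpa using fun d hd => add_vec_mem_shape_of_bond_ne_zero hd
    · rwa [Finset.sum_filter_ne_zero, Finset.sum_map]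

theorem isStable_of_shape_eq_singleton (h : shape α = {p}) : IsStable τ α := by
  constructor
  · unfold IsAssembly
    rw [h]
    have : Nonempty ({p} : Set Point) := ⟨p, rfl⟩
    exact ⟨fun u v => by rw [Subsingleton.elim u v]⟩
  · intro A hA hne hne'
    rw [h] at hA hne'
    rw [hne.subset_singleton_iff.1 hA, Set.sdiff_self] at hne'
    exact absurd hne' Set.not_nonempty_empty

theorem IsAssembly.update (hα : IsAssembly α) (hd : p + d.vec ∈ shape α) (t : T) :
    IsAssembly (Function.update α p (some t)) := by
  unfold IsAssembly
  have hpair := SimpleGraph.induce_pair_connected_of_adj (latticeGraph_adj_add_vec p d)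
  have hunion := SimpleGraph.induce_union_connected hpair.preconnected hα.preconnected
    ⟨p + d.vec, by simp, hd⟩
  rwa [Set.insert_union, Set.singleton_union, Set.insert_eq_of_mem hd, ← shape_update α p t]
    at hunion

theorem IsStable.update (hτ : 0 < τ) (hα : IsStable τ α) (hp : p ∉ shape α)
    (hs : τ ≤ ∑ d, bond (Function.update α p (some t)) p d) :
    IsStable τ (Function.update α p (some t)) := by
  set β := Function.update α p (some t)
  have hshape : shape β = insert p (shape α) := shape_update α p t
  have hβα : ∀ q ∈ shape α, β q = α q := fun q hq =>
    Function.update_of_ne (ne_of_mem_of_not_mem hq hp) _ _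
  have hcut := bondsAtLeast_singleton_iff.2 hs
  rw [hshape, Set.insert_sdiff_of_mem _ (Set.mem_singleton p),
    Set.sdiff_singleton_eq_self hp] at hcut
  obtain ⟨d, -, hd⟩ := Finset.exists_ne_zero_of_sum_ne_zero (hτ.trans_le hs).ne'
  have hdα : p + d.vec ∈ shape α :=
    (hshape.subset (add_vec_mem_shape_of_bond_ne_zero hd)).resolve_left (by simp)
  refine ⟨hα.1.update hdα t, fun A hA hne hne' => ?_⟩
  change BondsAtLeast τ β A (shape β \ A)
  rw [hshape] at hA hne' ⊢
  rcases (A ∩ shape α).eq_empty_or_nonempty with hempty | hne₁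
  · have hAp : A = {p} := hne.subset_singleton_iff.1 fun q hq =>
      (hA hq).resolve_right fun hqα => Set.notMem_empty q (hempty.subset ⟨hq, hqα⟩)
    rwa [hAp, Set.insert_sdiff_of_mem _ (Set.mem_singleton p), Set.sdiff_singleton_eq_self hp]
  rcases (shape α \ A).eq_empty_or_nonempty with hempty | hne₂
  · have hαA : shape α ⊆ A := Set.sdiff_eq_empty.1 hempty
    have hpA : p ∉ A := fun hpA => hne'.ne_empty (Set.sdiff_eq_empty.2 (Set.insert_subset hpA hαA))
    have hAα : A = shape α := ((Set.subset_insert_iff_of_notMem hpA).1 hA).antisymm hαA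
    rw [hAα, Set.insert_sdiff_of_notMem _ hp, Set.sdiff_self]
    simpa using hcut.symm
  · have h : BondsAtLeast τ α (A ∩ shape α) (shape α \ (A ∩ shape α)) :=
      hα.2 _ Set.inter_subset_right hne₁ (by rwa [Set.sdiff_inter_self_eq_sdiff])
    rw [Set.sdiff_inter_self_eq_sdiff] at h
    exact h.congr_mono (fun q hq => hβα q hq.2) (fun q hq => hβα q hq.1) Set.inter_subset_left
      (Set.sdiff_subset_sdiff_left (Set.subset_insert _ _))

theorem IsStable.le_sum_bond (hα : IsStable τ α) (hp : p ∈ shape α) (hq : q ∈ shape α)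
    (hqp : q ≠ p) : τ ≤ ∑ d, bond α p d :=
  bondsAtLeast_singleton_iff.1 <|
    hα.2 {p} (Set.singleton_subset_iff.2 hp) ⟨p, rfl⟩ ⟨q, hq, hqp⟩

end Stability

theorem TAS.step_iff {S : TAS} {α β : Configuration S.tiles} :
    S.Step α β ↔ IsStable S.temp α ∧ ∃ p ∉ shape α, ∃ t : S.tiles,
      β = Function.update α p (some t) ∧ S.temp ≤ ∑ d, bond β p d := by
  constructor
  · rintro ⟨hα, hβ, hsub, hcard⟩
    obtain ⟨p, hp⟩ := Set.encard_eq_one.1 hcard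
    obtain ⟨hpβ, hpα⟩ : p ∈ shape β \ shape α := hp.symm.subset rfl
    obtain ⟨t, ht⟩ := mem_shape.1 hpβ
    obtain ⟨⟨q, hq⟩⟩ := hα.1.nonempty
    have hqβ : q ∈ shape β := by
      rw [shape, Set.mem_ofPred_eq, hsub q hq]
      exact hq
    refine ⟨hα, p, hpα, t, funext fun r => ?_,
      hβ.le_sum_bond hpβ hqβ (ne_of_mem_of_not_mem hq hpα)⟩
    rcases eq_or_ne r p with rfl | hr
    · rw [ht, Function.update_self]
    rw [Function.update_of_ne hr]
    by_cases hrα : r ∈ shape α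
    · exact hsub r hrα
    · have hrβ : r ∉ shape β := fun h => hr (hp.subset ⟨h, hrα⟩)
      rw [show α r = none by simpa [shape] using hrα, show β r = none by simpa [shape] using hrβ]
  · rintro ⟨hα, p, hp, t, rfl, hs⟩
    refine ⟨hα, hα.update S.temp_pos hp hs, fun q hq =>
      Function.update_of_ne (ne_of_mem_of_not_mem hq hp) _ _, ?_⟩
    rw [shape_update, Set.insert_sdiff_of_notMem _ hp, Set.sdiff_self]
    simp

/-- Labels for the sides of tiles that carry information from tile to tile. The label `a` is bound
with strength `weight a`, and `IsInput a d` says that a tile with `a` on its side `d` receives `a`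
there, rather than offering it to its neighbour. -/
structure LabelSystem (Λ : Type*) where
  weight : Λ → ℕ
  weight_pos : ∀ a, 0 < weight a
  IsInput : Λ → Dir → Prop
  isInput_opp : ∀ a d, IsInput a d.opp ↔ ¬ IsInput a d

namespace LabelSystem

variable {Λ : Type*} (S : LabelSystem Λ)

/-- The tile with labels `t` has the input `a` on its side `d`. -/
def IsInputOf (t : Dir → Option Λ) (d : Dir) (a : Λ) : Prop := t d = some a ∧ S.IsInput a d

/-- The strength of the input on the side `d` of the tile with labels `t`, if there is one. -/
noncomputable def inputWeight (t : Dir → Option Λ) (d : Dir) : ℕ :=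
  (t d).elim 0 fun a => if S.IsInput a d then S.weight a else 0

variable {S} {t : Dir → Option Λ} {d : Dir} {a : Λ}

theorem IsInputOf.inputWeight (h : S.IsInputOf t d a) : S.inputWeight t d = S.weight a := by
  simp [LabelSystem.inputWeight, h.1, h.2]

theorem exists_isInputOf_of_inputWeight_ne_zero (h : S.inputWeight t d ≠ 0) :
    ∃ a, S.IsInputOf t d a := by
  cases ht : t d with
  | none => simp [LabelSystem.inputWeight, ht] at h
  | some a =>
    refine ⟨a, ht, ?_⟩
    by_contra ha
    simp [LabelSystem.inputWeight, ht, ha] at h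

variable (S) [Countable Λ]

/-- The glue that represents a label. -/
noncomputable def glue : Option Λ → Glue
  | none => ⟨[], 0, fun _ => rfl⟩
  | some a => ⟨List.replicate (Classical.choose (exists_injective_nat Λ) a) true, S.weight a,
      fun h => absurd h (S.weight_pos a).ne'⟩

theorem strength_glue (a : Option Λ) : (S.glue a).strength = a.elim 0 S.weight := by
  cases a <;> rfl

theorem glue_injective : Function.Injective S.glue := by
  intro a b h
  have hs := congrArg Glue.strength h
  have hl := congrArg (fun g => g.label.length) h
  rcases a with _ | a <;> rcases b with _ | b
  · rfl
  · exact absurd hs (S.weight_pos b).ne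
  · exact absurd hs (S.weight_pos a).ne'
  · simp only [glue, List.length_replicate] at hl
    rw [Classical.choose_spec (exists_injective_nat Λ) hl]

end LabelSystem

/-- A finite assembly at temperature `τ`, described by the labels on the sides of its tiles. The
tiles other than the first have inputs of total weight `τ`, which tiles of smaller rank supply, and
neighbours that supply inputs of total weight `τ` of some tile determine that tile. -/
structure Blueprint {Λ : Type*} (S : LabelSystem Λ) (τ : ℕ) where
  region : Finset Point
  label : Point → Dir → Option Λ
  start : Point
  start_mem : start ∈ region
  rank : Point → ℕ
  start_inputs : ∀ d a, ¬ S.IsInputOf (label start) d a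
  supplied : ∀ p ∈ region, ∀ d a, S.IsInputOf (label p) d a →
    p + d.vec ∈ region ∧ label (p + d.vec) d.opp = some a ∧ rank (p + d.vec) < rank p
  sum_inputWeight : ∀ p ∈ region, p ≠ start → ∑ d, S.inputWeight (label p) d = τ
  determined : ∀ p, ∀ r ∈ region, ∀ D : Finset Dir,
    (∀ d ∈ D, ∃ a, S.IsInputOf (label r) d a ∧ p + d.vec ∈ region ∧
      label (p + d.vec) d.opp = some a) →
    τ ≤ ∑ d ∈ D, S.inputWeight (label r) d → p ∈ region ∧ label p = label r

namespace Blueprint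

variable {Λ : Type*} [Countable Λ] {S : LabelSystem Λ} {τ : ℕ} (B : Blueprint S τ)

/-- The tile type at a location. -/
noncomputable def tile (p : Point) : TileType := fun d => S.glue (B.label p d)

theorem tile_eq_tile {p q : Point} : B.tile p = B.tile q ↔ B.label p = B.label q :=
  S.glue_injective.comp_left.eq_iff (a := B.label p) (b := B.label q)

/-- The tile types that occur in the blueprint. -/
noncomputable def tiles : Finset TileType := B.region.image B.tile

theorem tile_mem {p : Point} (hp : p ∈ B.region) : B.tile p ∈ B.tiles :=
  Finset.mem_image_of_mem _ hp

/-- The assembly that consists of the tile at the start. -/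
noncomputable def seed : Configuration B.tiles :=
  Function.update (fun _ => none) B.start (some ⟨B.tile B.start, B.tile_mem B.start_mem⟩)

theorem shape_seed : shape B.seed = {B.start} := by
  rw [seed, shape_update]
  simp [shape]

/-- The tile-assembly system of a blueprint. -/
noncomputable def system (hτ : 0 < τ) : TAS where
  tiles := B.tiles
  seed := B.seed
  temp := τ
  temp_pos := hτ
  seed_finite := by rw [shape_seed]; exact Set.finite_singleton _
  seed_stable := isStable_of_shape_eq_singleton B.shape_seed

/-- A configuration that agrees with the blueprint, contains the start, and contains with each tile
the neighbours that supply its inputs. -/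
structure IsPart (α : Configuration B.tiles) : Prop where
  start_mem : B.start ∈ shape α
  mem_region : ∀ p ∈ shape α, p ∈ B.region
  eq_tile : ∀ p t, α p = some t → t.1 = B.tile p
  input_mem : ∀ p ∈ shape α, ∀ d a, S.IsInputOf (B.label p) d a → p + d.vec ∈ shape α

theorem isPart_seed : B.IsPart B.seed where
  start_mem := by rw [shape_seed]; rfl
  mem_region p hp := by
    rw [shape_seed, Set.mem_singleton_iff] at hp
    exact hp ▸ B.start_mem
  eq_tile p t h := by
    obtain rfl : p = B.start := by simpa [shape_seed] using mem_shape.2 ⟨t, h⟩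
    rw [seed, Function.update_self, Option.some_inj] at h
    rw [← h]
  input_mem p hp d a h := by
    rw [shape_seed, Set.mem_singleton_iff] at hp
    exact absurd (hp ▸ h) (B.start_inputs d a)

variable {B} {hτ : 0 < τ} {α β : Configuration B.tiles} {p q r : Point} {d : Dir} {t : B.tiles}

theorem bond_eq_ite {s u : B.tiles} (hs : α p = some s) (hsr : s.1 = B.tile r)
    (hu : α (p + d.vec) = some u) (huq : u.1 = B.tile q) :
    bond α p d =
      if B.label r d = B.label q d.opp then (B.label r d).elim 0 S.weight else 0 := by
  rw [bond_of_eq_some hs hu, hsr, huq]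
  simp only [tile, S.glue_injective.eq_iff, S.strength_glue]

namespace IsPart

theorem update (hα : B.IsPart α) (hp : p ∈ B.region) (ht : t.1 = B.tile p)
    (hin : ∀ d a, S.IsInputOf (B.label p) d a → p + d.vec ∈ shape α) :
    B.IsPart (Function.update α p (some t)) where
  start_mem := by
    rw [shape_update]
    exact Or.inr hα.start_mem
  mem_region q hq := by
    rw [shape_update] at hq
    exact hq.elim (fun h => h ▸ hp) (hα.mem_region q)
  eq_tile q u hu := by
    rcases eq_or_ne q p with rfl | hqp
    · rw [Function.update_self, Option.some_inj] at hu
      rw [← hu, ht]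
    · exact hα.eq_tile q u (by rwa [Function.update_of_ne hqp] at hu)
  input_mem q hq d a h := by
    rw [shape_update] at hq ⊢
    rcases hq with rfl | hq
    · exact Or.inr (hin d a h)
    · exact Or.inr (hα.input_mem q hq d a h)

-- The neighbour was there before the new tile, so it does not receive the common label.
theorem exists_isInputOf_of_bond_ne_zero (hα : B.IsPart α) (hp : p ∉ shape α)
    (ht : t.1 = B.tile r) (h : bond (Function.update α p (some t)) p d ≠ 0) :
    ∃ a, S.IsInputOf (B.label r) d a ∧ p + d.vec ∈ shape α ∧
      B.label (p + d.vec) d.opp = some a ∧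
      bond (Function.update α p (some t)) p d = S.inputWeight (B.label r) d := by
  have hq : p + d.vec ∈ shape α := by
    have hq := add_vec_mem_shape_of_bond_ne_zero h
    rw [shape_update] at hq
    exact hq.resolve_left (by simp)
  obtain ⟨u, hu⟩ := mem_shape.1 hq
  have hbond := bond_eq_ite (Function.update_self p (some t) α) ht
    ((Function.update_of_ne (by simp) _ _).trans hu) (hα.eq_tile _ _ hu)
  have heq : B.label r d = B.label (p + d.vec) d.opp := by
    by_contra hne
    exact h (hbond.trans (if_neg hne))
  rw [if_pos heq] at hbond
  cases ha : B.label r d with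
  | none => exact absurd (by rw [hbond, ha]; rfl) h
  | some a =>
    have hin : S.IsInputOf (B.label r) d a := by
      refine ⟨ha, ?_⟩
      by_contra hout
      have hp' := hα.input_mem _ hq d.opp a ⟨heq ▸ ha, (S.isInput_opp a d).2 hout⟩
      rw [Dir.add_vec_add_opp_vec] at hp'
      exact hp hp'
    exact ⟨a, hin, hq, heq ▸ ha, by rw [hbond, ha, hin.inputWeight]; rfl⟩

theorem of_step (hα : B.IsPart α) (h : (B.system hτ).Step α β) : B.IsPart β := by
  obtain ⟨-, p, hp, t, rfl, hs⟩ := TAS.step_iff.1 h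
  obtain ⟨r, hr, hrt⟩ := Finset.mem_image.1 t.2
  have hstart : p ≠ B.start := fun h => hp (h ▸ hα.start_mem)
  set D : Finset Dir := {d | bond (Function.update α p (some t)) p d ≠ 0} with hD
  have hbound : ∀ d ∈ D, ∃ a, S.IsInputOf (B.label r) d a ∧ p + d.vec ∈ shape α ∧
      B.label (p + d.vec) d.opp = some a ∧
      bond (Function.update α p (some t)) p d = S.inputWeight (B.label r) d := fun d hd =>
    hα.exists_isInputOf_of_bond_ne_zero hp hrt.symm (by simpa [hD] using hd)
  have hsum : τ ≤ ∑ d ∈ D, S.inputWeight (B.label r) d := by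
    refine hs.trans_eq ?_
    rw [← Finset.sum_filter_ne_zero]
    exact Finset.sum_congr rfl fun d hd => (hbound d hd).choose_spec.2.2.2
  obtain ⟨hpR, hpr⟩ := B.determined p r hr D (fun d hd => by
    obtain ⟨a, hin, hq, ha, -⟩ := hbound d hd
    exact ⟨a, hin, hα.mem_region _ hq, ha⟩) hsum
  -- The bonds exhaust the total weight of the inputs, so every input is bound.
  have hzero : ∀ d ∉ D, S.inputWeight (B.label p) d = 0 := by
    intro d hd
    have hτd := B.sum_inputWeight p hpR hstart
    have hle := Finset.sum_le_sum_of_subset (f := S.inputWeight (B.label p))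
      (Finset.subset_univ (insert d D))
    rw [Finset.sum_insert hd, hτd] at hle
    rw [hpr] at hle ⊢
    omega
  refine hα.update hpR (by rw [← hrt, B.tile_eq_tile.2 hpr]) fun d a hin => ?_
  have hd : d ∈ D := by
    by_contra hd
    exact (S.weight_pos a).ne' (hin.inputWeight ▸ hzero d hd)
  exact (hbound d hd).choose_spec.2.1

theorem of_mem_producible (hα : α ∈ (B.system hτ).producible) : B.IsPart α := by
  rcases hα with h | ⟨s, h0, hs, hα⟩
  · induction h with
    | refl => exact B.isPart_seed
    | tail _ h ih => exact ih.of_step h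
  · have hpart : ∀ i, B.IsPart (s i) := fun i => by
      induction i with
      | zero => exact h0 ▸ B.isPart_seed
      | succ i ih => exact ih.of_step (hs i)
    have hmem : ∀ p, p ∈ shape α ↔ ∃ i, p ∈ shape (s i) := fun p => by
      simp only [mem_shape]
      exact (exists_congr (hα p)).trans exists_comm
    refine ⟨(hmem _).2 ⟨0, (hpart 0).start_mem⟩, fun p hp => ?_, fun p t ht => ?_,
      fun p hp d a hin => ?_⟩
    · obtain ⟨i, hi⟩ := (hmem p).1 hp
      exact (hpart i).mem_region p hi
    · obtain ⟨i, hi⟩ := (hα p t).1 ht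
      exact (hpart i).eq_tile p t hi
    · obtain ⟨i, hi⟩ := (hmem p).1 hp
      exact (hmem _).2 ⟨i, (hpart i).input_mem p hi d a hin⟩

-- A missing location of minimal rank has all its inputs.
theorem exists_step (hα : B.IsPart α) (hst : IsStable τ α) (hne : ∃ p ∈ B.region, p ∉ shape α) :
    ∃ β, (B.system hτ).Step α β := by
  obtain ⟨p, ⟨hpR, hpα⟩, hmin⟩ :=
    exists_minimalFor_of_wellFoundedLT (fun p => p ∈ B.region ∧ p ∉ shape α) B.rank hne
  set t : B.tiles := ⟨B.tile p, B.tile_mem hpR⟩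
  have hle : ∀ d, S.inputWeight (B.label p) d ≤ bond (Function.update α p (some t)) p d := by
    intro d
    by_cases hd : S.inputWeight (B.label p) d = 0
    · exact hd ▸ Nat.zero_le _
    obtain ⟨a, hin⟩ := LabelSystem.exists_isInputOf_of_inputWeight_ne_zero hd
    obtain ⟨hqR, hqa, hrank⟩ := B.supplied p hpR d a hin
    have hq : p + d.vec ∈ shape α := by
      by_contra hq
      exact (hmin ⟨hqR, hq⟩ hrank.le).not_gt hrank
    obtain ⟨u, hu⟩ := mem_shape.1 hq
    rw [bond_eq_ite (Function.update_self p (some t) α) rfl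
      ((Function.update_of_ne (by simp) _ _).trans hu) (hα.eq_tile _ _ hu), hqa, hin.1, if_pos rfl,
      hin.inputWeight]
    rfl
  refine ⟨Function.update α p (some t), TAS.step_iff.2 ⟨hst, p, hpα, t, rfl, ?_⟩⟩
  calc τ = ∑ d, S.inputWeight (B.label p) d :=
        (B.sum_inputWeight p hpR fun h => hpα (h ▸ hα.start_mem)).symm
    _ ≤ ∑ d, bond (Function.update α p (some t)) p d := Finset.sum_le_sum fun d _ => hle d

end IsPart

theorem exists_eq_some_of_mem_terminal (hα : α ∈ (B.system hτ).terminal) (hp : p ∈ B.region) :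
    ∃ t, α p = some t ∧ t.1 = B.tile p := by
  obtain ⟨hprod, hst, hterm⟩ := hα
  have hpart := IsPart.of_mem_producible hprod
  by_contra! hne
  obtain ⟨β, hβ⟩ := hpart.exists_step hst ⟨p, hp, fun h => by
    obtain ⟨t, ht⟩ := mem_shape.1 h
    exact hne t ht (hpart.eq_tile p t ht)⟩
  exact hterm β hβ

theorem eq_none_of_mem_terminal (hα : α ∈ (B.system hτ).terminal) (hp : p ∉ B.region) :
    α p = none := by
  by_contra h
  exact hp ((IsPart.of_mem_producible hα.1).mem_region p h)

theorem card_tiles_le : B.tiles.card ≤ (B.region.image B.label).card := by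
  have htiles : B.tiles = (B.region.image B.label).image (S.glue ∘ ·) := by
    rw [Finset.image_image]
    rfl
  exact htiles ▸ Finset.card_image_le

variable {C : Type*} {black white : C} {L : Finset Point}

theorem colorAt_of_mem_terminal
    (hL : ∀ p ∈ L, ∀ q ∈ B.region, B.label q = B.label p → q ∈ L)
    (hα : α ∈ (B.system hτ).terminal) (hp : p ∈ B.region) :
    colorAt (fun t : B.tiles => if ∃ q ∈ L, t.1 = B.tile q then black else white) α p =
      some (if p ∈ L then black else white) := by
  obtain ⟨t, ht, htp⟩ := exists_eq_some_of_mem_terminal hα hp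
  have hiff : (∃ q ∈ L, t.1 = B.tile q) ↔ p ∈ L := by
    rw [htp]
    refine ⟨?_, fun h => ⟨p, h, rfl⟩⟩
    rintro ⟨q, hq, h⟩
    exact hL q hq p hp (B.tile_eq_tile.1 h)
  simp only [colorAt, ht, Option.map_some, hiff]

theorem exists_weaklySelfAssembles (B : Blueprint S τ) (hτ : 0 < τ)
    (hL : ∀ p ∈ L, ∀ q ∈ B.region, B.label q = B.label p → q ∈ L) {P : Pattern C}
    (hP : ∀ p c, (p, c) ∈ P ↔ p ∈ B.region ∧ c = if p ∈ L then black else white) :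
    ∃ (S : TAS) (color : S.tiles → C), S.temp = τ ∧ S.SinglySeeded ∧
      S.tiles.card ≤ (B.region.image B.label).card ∧
      S.WeaklySelfAssembles color {black, white} P := by
  refine ⟨B.system hτ, fun t => if ∃ p ∈ L, t.1 = B.tile p then black else white, rfl, ?_,
    B.card_tiles_le, fun α hα => ⟨?_, ?_⟩⟩
  · change (shape B.seed).encard = 1
    rw [shape_seed, Set.encard_singleton]
  · ext p
    constructor
    · rintro ⟨c, -, hc⟩
      by_cases hp : p ∈ B.region
      · exact ⟨_, (hP p _).2 ⟨hp, rfl⟩⟩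
      · have hnone : α p = none := eq_none_of_mem_terminal hα hp
        rw [colorAt, hnone] at hc
        cases hc
    · rintro ⟨c, hc⟩
      refine ⟨_, ?_, colorAt_of_mem_terminal hL hα ((hP _ _).1 hc).1⟩
      split_ifs <;> simp
  · intro p c hc
    obtain ⟨hp, rfl⟩ := (hP _ _).1 hc
    exact colorAt_of_mem_terminal hL hα hp

end Blueprint

section BinaryIncrement

/-- The carry into position `a` when `c` is incremented. -/
def carryBit (c a : ℕ) : Bool := decide (2 ^ a ∣ c + 1)

theorem carryBit_zero (c : ℕ) : carryBit c 0 = true := by simp [carryBit]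

theorem testBit_add_one (c a : ℕ) : (c + 1).testBit a = (c.testBit a ^^ carryBit c a) := by
  rw [Nat.testBit_eq_decide_div_mod_eq, Nat.testBit_eq_decide_div_mod_eq, Nat.succ_div, carryBit]
  by_cases h : 2 ^ a ∣ c + 1
  · rcases Nat.mod_two_eq_zero_or_one (c / 2 ^ a) with h2 | h2 <;> simp [h, Nat.add_mod, h2]
  · simp [h]

theorem carryBit_add_one (c a : ℕ) : carryBit c (a + 1) = (c.testBit a && carryBit c a) := by
  rw [Nat.testBit_eq_decide_div_mod_eq, carryBit, carryBit, ← Bool.decide_and, decide_eq_decide]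
  by_cases h : 2 ^ a ∣ c + 1
  · rw [pow_succ, ← Nat.dvd_div_iff_mul_dvd h, Nat.succ_div, if_pos h]
    simp only [h, and_true]
    omega
  · simp only [h, and_false, iff_false]
    exact fun h' => h ((pow_dvd_pow 2 (Nat.le_succ a)).trans h')

theorem carryBit_two_pow_sub {w v : ℕ} (h1 : 1 ≤ v) (h2 : v ≤ 2 ^ w) :
    carryBit (2 ^ w - v) w = decide (v = 1) := by
  rw [carryBit, decide_eq_decide]
  constructor
  · intro h
    have := Nat.le_of_dvd (by omega) h
    omega
  · rintro rfl
    rw [Nat.sub_add_cancel h2]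

end BinaryIncrement

namespace Dir

theorem sum_univ {M : Type*} [AddCommMonoid M] (f : Dir → M) :
    ∑ d, f d = f .north + f .east + f .south + f .west := by
  have huniv : (Finset.univ : Finset Dir) = {.north, .east, .south, .west} := rfl
  rw [huniv]
  simp [add_assoc]

/-- The sides to the south and to the west, through which most information enters a tile. -/
def isLow : Dir → Bool
  | .south => true
  | .west => true
  | _ => false

/-- The reflection of the sides in the diagonal for `o = true`, and the identity otherwise. -/
def reflect : Bool → Dir → Dir
  | false, d => d
  | true, .north => .east
  | true, .east => .north
  | true, .south => .west
  | true, .west => .south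

@[simp]
theorem reflect_reflect (o : Bool) (d : Dir) : reflect o (reflect o d) = d := by
  cases o <;> cases d <;> rfl

@[simp]
theorem isLow_reflect (o : Bool) (d : Dir) : (reflect o d).isLow = d.isLow := by
  cases o <;> cases d <;> rfl

theorem opp_reflect (o : Bool) (d : Dir) : (reflect o d).opp = reflect o d.opp := by
  cases o <;> cases d <;> rfl

theorem involutive_reflect (o : Bool) : Function.Involutive (reflect o) := reflect_reflect o

theorem sum_comp_reflect {M : Type*} [AddCommMonoid M] (o : Bool) (f : Dir → M) :
    ∑ d, f (reflect o d) = ∑ d, f d :=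
  (involutive_reflect o).bijective.sum_comp f

end Dir

/-- The labels of a comb. The flag `o` tells the horizontal teeth (`true`) from the vertical spine
(`false`). The label `enter p` leads to the hard-coded location `p`, and `fill` surrounds the tiles
outside the comb. The others belong to the counters: `start`, `bit`, `turn`, `copy` and `home`
carry a digit `b` from line to line, where `start` and `home` remember the location `p` to enter
when the counter overflows; `carry` and `flag` carry the carry bit and the overflow flag along a
line. -/
inductive CombLabel : Type
  | enter (p : Point)
  | start (o : Bool) (p : Point) (b : Bool)
  | bit (o b last : Bool)
  | carry (o c : Bool)
  | turn (o b f : Bool)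
  | copy (o b : Bool)
  | home (o : Bool) (p : Point) (b : Bool)
  | flag (o f : Bool)
  | fill (o : Bool)
  deriving Countable

namespace CombLabel

/-- The strength with which a label is bound. -/
def weight : CombLabel → ℕ
  | enter _ => 2
  | start _ _ _ => 2
  | turn _ _ _ => 2
  | _ => 1

/-- Labels are passed on to the north and to the east, except for flags, which are passed on to
the south and to the west. -/
def IsInput : CombLabel → Dir → Prop
  | flag _ _, d => d.isLow = false
  | _, d => d.isLow = true

theorem isInput_opp (a : CombLabel) (d : Dir) : a.IsInput d.opp ↔ ¬ a.IsInput d := by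
  cases a <;> cases d <;> simp [IsInput, Dir.opp, Dir.isLow]

@[simp]
theorem isInput_reflect (a : CombLabel) (o : Bool) (d : Dir) :
    a.IsInput (Dir.reflect o d) ↔ a.IsInput d := by
  cases a <;> simp [IsInput]

/-- The label system of the combs. -/
def system : LabelSystem CombLabel where
  weight := weight
  weight_pos a := by cases a <;> simp [weight]
  IsInput := IsInput
  isInput_opp := isInput_opp

theorem inputWeight_comp_reflect (t : Dir → Option CombLabel) (o : Bool) (d : Dir) :
    system.inputWeight (t ∘ Dir.reflect o) d = system.inputWeight t (Dir.reflect o d) := by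
  simp only [LabelSystem.inputWeight, Function.comp_apply]
  cases t (Dir.reflect o d) with
  | none => rfl
  | some a => exact if_congr (isInput_reflect a o d).symm rfl rfl

theorem isInputOf_comp_reflect {t : Dir → Option CombLabel} {o : Bool} {d : Dir}
    {a : CombLabel} :
    system.IsInputOf (t ∘ Dir.reflect o) d a ↔ system.IsInputOf t (Dir.reflect o d) a := by
  simp [LabelSystem.IsInputOf, system]

end CombLabel

/-- The tiles of the counters, up to orientation. The tiles `lead` and `add` process a line of
digits from the low to the high end and increment it; the others copy the result on the way back,
and have a flag `f` that tells whether the counter overflows. -/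
inductive CounterTile : Type
  | lead (p : Point) (b : Bool)
  | add (b last c : Bool)
  | turn (b f : Bool)
  | copy (b f : Bool)
  | home (p : Point) (b f : Bool)

namespace CounterTile

/-- The labels of a counter tile of a vertical strip, where lines are rows and the low end is in
the west. -/
def label (o : Bool) : CounterTile → Dir → Option CombLabel
  | lead p b, .south => some (.start o p b)
  | lead p b, .north => some (.home o p (!b))
  | lead _ _, .west => none
  | lead _ b, .east => some (.carry o b)
  | add b l _, .south => some (.bit o b l)
  | add b l c, .north => if l then some (.turn o (b ^^ c) (b && c)) else some (.copy o (b ^^ c))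
  | add _ _ c, .west => some (.carry o c)
  | add b l c, .east => if l then some (.fill o) else some (.carry o (b && c))
  | turn b f, .south => some (.turn o b f)
  | turn b f, .north => if f then none else some (.bit o b true)
  | turn _ f, .west => some (.flag o f)
  | turn _ _, .east => some (.fill o)
  | copy b _, .south => some (.copy o b)
  | copy b f, .north => if f then none else some (.bit o b false)
  | copy _ f, .west => some (.flag o f)
  | copy _ f, .east => some (.flag o f)
  | home p b _, .south => some (.home o p b)
  | home p b f, .north => if f then some (.enter p) else some (.start o p b)
  | home _ _ _, .west => none
  | home _ _ f, .east => some (.flag o f)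

/-- The location to enter that a counter tile remembers. -/
def target : CounterTile → Option Point
  | lead p _ => some p
  | home p _ _ => some p
  | _ => none

/-- The inputs of the counter tiles. -/
inductive Input (o : Bool) : CounterTile → Dir → CombLabel → Prop
  | lead (p b) : Input o (lead p b) .south (.start o p b)
  | add_bit (b l c) : Input o (add b l c) .south (.bit o b l)
  | add_carry (b l c) : Input o (add b l c) .west (.carry o c)
  | turn (b f) : Input o (turn b f) .south (.turn o b f)
  | copy_bit (b f) : Input o (copy b f) .south (.copy o b)
  | copy_flag (b f) : Input o (copy b f) .east (.flag o f)
  | home_bit (p b f) : Input o (home p b f) .south (.home o p b)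
  | home_flag (p b f) : Input o (home p b f) .east (.flag o f)

variable {o : Bool} {s : CounterTile} {d : Dir} {a : CombLabel}

theorem input_of_isInputOf (h : CombLabel.system.IsInputOf (s.label o) d a) : s.Input o d a := by
  obtain ⟨h, hin⟩ := h
  cases s <;> cases d <;> simp only [label] at h <;> (try split_ifs at h) <;> cases h <;>
    first
    | constructor
    | simp [CombLabel.system, CombLabel.IsInput, Dir.isLow] at hin

theorem sum_inputWeight_label (o : Bool) (s : CounterTile) :
    ∑ d, CombLabel.system.inputWeight (s.label o) d = 2 := by
  rw [Dir.sum_univ]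
  cases s <;> simp only [LabelSystem.inputWeight, label] <;> (try split_ifs) <;>
    simp [CombLabel.system, CombLabel.IsInput, CombLabel.weight, Dir.isLow]

variable {o' : Bool} {s' : CounterTile} {e d' e' : Dir} {b : CombLabel}

theorem Input.eq_of_weight_ne_one (h : s.Input o d a) (h' : s'.Input o' d' a)
    (ha : a.weight ≠ 1) : o = o' ∧ s = s' := by
  cases h <;> first | exact absurd rfl ha | (cases h'; exact ⟨rfl, rfl⟩)

theorem Input.eq_of_ne (hde : d ≠ e) (ha : s.Input o d a) (hb : s.Input o e b)
    (ha' : s'.Input o' d' a) (hb' : s'.Input o' e' b) : o = o' ∧ s = s' := by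
  cases ha <;> cases hb <;> first
    | exact absurd rfl hde
    | (cases ha' <;> cases hb'; exact ⟨rfl, rfl⟩)

theorem not_input_enter (p : Point) : ¬ s.Input o d (.enter p) := nofun

theorem not_input_fill (o' : Bool) : ¬ s.Input o d (.fill o') := nofun

theorem exists_finset_card_le (H : Finset Point) : ∃ T : Finset CounterTile,
    T.card ≤ 6 * H.card + 16 ∧ ∀ s : CounterTile, (∀ p ∈ s.target, p ∈ H) → s ∈ T := by
  let leads := (H ×ˢ Finset.univ).image fun x : Point × Bool => lead x.1 x.2
  let adds := Finset.univ.image fun x : Bool × Bool × Bool => add x.1 x.2.1 x.2.2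
  let turns := Finset.univ.image fun x : Bool × Bool => turn x.1 x.2
  let copies := Finset.univ.image fun x : Bool × Bool => copy x.1 x.2
  let homes := (H ×ˢ Finset.univ).image fun x : Point × Bool × Bool => home x.1 x.2.1 x.2.2
  refine ⟨leads ∪ adds ∪ turns ∪ copies ∪ homes, ?_, fun s hs => ?_⟩
  · have hleads : leads.card ≤ H.card * 2 := Finset.card_image_le.trans (by simp)
    have hadds : adds.card ≤ 8 := Finset.card_image_le
    have hturns : turns.card ≤ 4 := Finset.card_image_le
    have hcopies : copies.card ≤ 4 := Finset.card_image_le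
    have hhomes : homes.card ≤ H.card * 4 := Finset.card_image_le.trans (by simp)
    grw [Finset.card_union_le, Finset.card_union_le, Finset.card_union_le, Finset.card_union_le]
    omega
  · cases s <;> simp_all [target, leads, adds, turns, copies, homes]

end CounterTile

/-- The kinds of tiles of a comb: those that are hard-coded for one location, the counter tiles of
the spine and of the teeth, and the tile that fills the rest of the square. -/
inductive Kind : Type
  | hard (p : Point)
  | counter (o : Bool) (s : CounterTile)
  | fill

namespace Kind

/-- The location that a kind of tile depends on. -/
def target : Kind → Option Point
  | hard p => some p
  | counter _ s => s.target
  | fill => none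

/-- The labels that a kind accepts as inputs. -/
inductive Input : Kind → Dir → CombLabel → Prop
  | hard (p d) : Input (hard p) d (.enter p)
  | counter {o s d a} (h : CounterTile.Input o s (Dir.reflect o d) a) : Input (counter o s) d a
  | fill_south : Input fill .south (.fill true)
  | fill_west : Input fill .west (.fill false)

variable {k k' : Kind} {d e : Dir} {a b : CombLabel}

theorem Input.eq_of_weight_ne_one (h : k.Input d a) (h' : k'.Input d a) (ha : a.weight ≠ 1) :
    k = k' := by
  cases h with
  | hard p => cases h' with
    | hard => rfl
    | counter h' => exact absurd h' (CounterTile.not_input_enter p)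
  | counter h => cases h' with
    | hard p => exact absurd h (CounterTile.not_input_enter p)
    | counter h' =>
      obtain ⟨rfl, rfl⟩ := h.eq_of_weight_ne_one h' ha
      rfl
    | _ => exact absurd h (CounterTile.not_input_fill _)
  | _ => exact absurd rfl ha

theorem Input.eq_of_ne (hde : d ≠ e) (ha : k.Input d a) (hb : k.Input e b) (ha' : k'.Input d a)
    (hb' : k'.Input e b) : k = k' := by
  cases ha with
  | hard p => exact (Input.hard p d).eq_of_weight_ne_one ha' (by simp [CombLabel.weight])
  | counter ha =>
    obtain _ | hb := hb
    cases ha' with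
    | hard p => exact absurd ha (CounterTile.not_input_enter p)
    | counter ha' => cases hb' with
      | counter hb' =>
        obtain ⟨rfl, rfl⟩ := ha.eq_of_ne ((Dir.involutive_reflect _).injective.ne hde) hb ha' hb'
        rfl
    | _ => exact absurd ha (CounterTile.not_input_fill _)
  | _ => cases ha' with
    | counter h => exact absurd h (CounterTile.not_input_fill _)
    | _ => rfl

theorem Input.ne_fill (h : k.Input d a) (hk : k ≠ fill) (o : Bool) : a ≠ .fill o := by
  rintro rfl
  cases h with
  | counter h => exact CounterTile.not_input_fill o h
  | _ => exact hk rfl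

theorem exists_finset_card_le (H : Finset Point) : ∃ T : Finset Kind,
    T.card ≤ 13 * H.card + 33 ∧ ∀ k : Kind, (∀ p ∈ k.target, p ∈ H) → k ∈ T := by
  obtain ⟨T, hcard, hT⟩ := CounterTile.exists_finset_card_le H
  let counters := (Finset.univ ×ˢ T).image fun x : Bool × CounterTile => counter x.1 x.2
  refine ⟨H.image hard ∪ counters ∪ {fill}, ?_, fun k hk => ?_⟩
  · have hcounters : counters.card ≤ 2 * T.card := Finset.card_image_le.trans (by simp)
    have hhard : (H.image hard).card ≤ H.card := Finset.card_image_le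
    grw [Finset.card_union_le, Finset.card_union_le, Finset.card_singleton]
    omega
  · cases k <;> simp_all [target, counters]

end Kind

/-- The parameters of a comb in the `n × n` square for the pixels `L`. The comb consists of a
vertical spine of width `h` along the west side, and of horizontal teeth of height at least `h`
from the spine to the east side that contain the other pixels. -/
structure Comb where
  n : ℕ
  h : ℕ
  L : Finset Point
  two_le : 2 ≤ h
  h_le : h ≤ n
  n_le : n ≤ 2 ^ h
  mem_square : ∀ p ∈ L, p ∈ square n

namespace Comb

section Slabs

variable (C : Comb) {y j : ℕ}

/-- The slab of a row. Slab `j` starts in row `h * j` and consists of `h` rows, except that the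
last slab also contains the `n % h` remaining rows. -/
def slab (y : ℕ) : ℕ := min (y / C.h) (C.n / C.h - 1)

/-- The number of rows of a slab. -/
def slabHeight (j : ℕ) : ℕ := if j + 1 = C.n / C.h then C.h + C.n % C.h else C.h

theorem slab_lt (y : ℕ) : C.slab y < C.n / C.h := by
  have : 0 < C.n / C.h := Nat.div_pos C.h_le (by have := C.two_le; omega)
  unfold slab
  omega

theorem h_le_slabHeight (j : ℕ) : C.h ≤ C.slabHeight j := by
  unfold slabHeight
  split_ifs <;> omega

theorem slabHeight_le (j : ℕ) : C.slabHeight j ≤ 2 * C.h := by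
  have := Nat.mod_lt C.n (y := C.h) (by have := C.two_le; omega)
  unfold slabHeight
  split_ifs <;> omega

variable {C}

theorem mul_add_slabHeight_le (hj : j < C.n / C.h) : C.h * j + C.slabHeight j ≤ C.n := by
  have hn := Nat.div_add_mod C.n C.h
  have hmul : C.h * (j + 1) ≤ C.h * (C.n / C.h) := Nat.mul_le_mul_left _ hj
  have hsucc : C.h * (j + 1) = C.h * j + C.h := rfl
  unfold slabHeight
  split_ifs with hlast
  · rw [← hlast] at hn
    omega
  · omega

theorem slab_eq_iff (hj : j < C.n / C.h) (hy : y < C.n) :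
    C.slab y = j ↔ C.h * j ≤ y ∧ y < C.h * j + C.slabHeight j := by
  have hpos : 0 < C.h := by have := C.two_le; omega
  have hn := Nat.div_add_mod C.n C.h
  have hle := Nat.le_div_iff_mul_le hpos (x := j) (y := y)
  have hlt := Nat.div_lt_iff_lt_mul hpos (x := y) (y := j + 1)
  rw [mul_comm] at hle
  rw [mul_comm, mul_add_one] at hlt
  unfold slab slabHeight
  split_ifs with hlast
  · rw [← hlast, mul_add_one] at hn
    omega
  · omega

theorem mul_slab_le (hy : y < C.n) : C.h * C.slab y ≤ y :=
  ((slab_eq_iff (C.slab_lt y) hy).1 rfl).1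

theorem lt_mul_slab_add (hy : y < C.n) : y < C.h * C.slab y + C.slabHeight (C.slab y) :=
  ((slab_eq_iff (C.slab_lt y) hy).1 rfl).2

theorem slab_add_one (hy : y + 1 < C.n) : C.slab (y + 1) = C.slab y ∨
    y + 1 = C.h * C.slab (y + 1) ∧ y + 1 = C.h * C.slab y + C.slabHeight (C.slab y) := by
  have hle := mul_slab_le (Nat.lt_of_succ_lt hy)
  have hlt := lt_mul_slab_add (Nat.lt_of_succ_lt hy)
  have hj := C.slab_lt y
  by_cases h : y + 1 < C.h * C.slab y + C.slabHeight (C.slab y)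
  · exact Or.inl ((slab_eq_iff hj hy).2 ⟨by omega, h⟩)
  · have hnext : C.slab y + 1 ≠ C.n / C.h := by
      intro hlast
      have hn := Nat.div_add_mod C.n C.h
      rw [← hlast, mul_add_one] at hn
      simp only [slabHeight, hlast, if_true] at h
      omega
    have hheight : C.slabHeight (C.slab y) = C.h := if_neg hnext
    have hstart : C.h * (C.slab y + 1) = y + 1 := by rw [mul_add_one]; omega
    have hslab : C.slab (y + 1) = C.slab y + 1 := by
      refine (slab_eq_iff (by omega) hy).2 ⟨hstart.le, ?_⟩
      have := C.h_le_slabHeight (C.slab y + 1)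
      have := C.two_le
      omega
    exact Or.inr ⟨by rw [hslab, hstart], by omega⟩

end Slabs

section Strips

variable (C : Comb)

/-- The slabs that are teeth of the comb. -/
def teeth : Finset ℕ := insert 0 (C.L.image fun p => C.slab p.2.toNat)

/-- The strips of the comb, where `none` is the spine and `some j` is the tooth in slab `j`. -/
def strips : Finset (Option ℕ) := Finset.insertNone C.teeth

/-- The width of a strip. A line of a strip consists of this number of locations. -/
def width : Option ℕ → ℕ
  | none => C.h
  | some j => C.slabHeight j

/-- The first line of a strip. -/
def firstLine : Option ℕ → ℕ
  | none => 0
  | some _ => C.h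

/-- The location at position `a` of line `l` of a strip. -/
def place : Option ℕ → ℕ → ℕ → Point
  | none, a, l => (a, l)
  | some j, a, l => (l, C.h * j + a)

/-- The positions of the strips. -/
structure InStrip (σ : Option ℕ) (a l : ℕ) : Prop where
  mem_strips : σ ∈ C.strips
  lt_width : a < C.width σ
  firstLine_le : C.firstLine σ ≤ l
  lt_n : l < C.n

/-- The lines of a strip that have to be hard-coded: the first and the last line, the lines in
which another strip starts, and the lines that contain pixels. -/
def hardLines : Option ℕ → Finset ℕ
  | none => {0, C.n - 1} ∪ C.teeth.image (C.h * ·) ∪ C.L.image fun p => p.2.toNat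
  | some j => {C.h, C.n - 1} ∪ (C.L.filter fun p => C.slab p.2.toNat = j).image fun p => p.1.toNat

/-- The index of the pair of a line. The shift ensures that the last line is the second one of
its pair. -/
def pair (l : ℕ) : ℕ := (l + C.n % 2) / 2

/-- The second lines of the pairs, in which the result of the increment returns to the low end. -/
def IsReturn (l : ℕ) : Prop := (l + C.n % 2) % 2 = 1

/-- The pairs of lines that are hard-coded. -/
def hardPairs (σ : Option ℕ) : Finset ℕ := (C.hardLines σ).image C.pair

/-- The next hard-coded pair. -/
noncomputable def nextHard (σ : Option ℕ) (P : ℕ) : ℕ := sInf {Q | Q ∈ C.hardPairs σ ∧ P < Q}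

/-- The value of the counter on arrival at a pair of lines. It overflows in the last pair before
the next hard-coded one. -/
noncomputable def counter (σ : Option ℕ) (P : ℕ) : ℕ := 2 ^ C.width σ - (C.nextHard σ P - P)

/-- The overflow flag of the counter. -/
def endFlag (σ : Option ℕ) (P : ℕ) : Bool := decide (P + 1 ∈ C.hardPairs σ)

/-- The first location of the next hard-coded pair. -/
noncomputable def entry (σ : Option ℕ) (P : ℕ) : Point :=
  C.place σ 0 (2 * C.nextHard σ P - C.n % 2)

variable {C} {σ : Option ℕ} {a l P Q : ℕ}

theorem some_mem_strips {j : ℕ} : some j ∈ C.strips ↔ j ∈ C.teeth :=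
  Finset.some_mem_insertNone

theorem lt_of_mem_teeth {j : ℕ} (hj : j ∈ C.teeth) : j < C.n / C.h := by
  simp only [teeth, Finset.mem_insert, Finset.mem_image] at hj
  obtain rfl | ⟨p, -, rfl⟩ := hj
  · exact (Nat.zero_le _).trans_lt (C.slab_lt 0)
  · exact C.slab_lt _

variable (C) in
theorem h_le_width (σ : Option ℕ) : C.h ≤ C.width σ := by
  cases σ with
  | none => exact le_rfl
  | some j => exact C.h_le_slabHeight j

variable (C) in
theorem width_le_two_mul (σ : Option ℕ) : C.width σ ≤ 2 * C.h := by
  cases σ with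
  | none => exact Nat.le_mul_of_pos_left _ two_pos
  | some j => exact C.slabHeight_le j

variable (C) in
theorem two_le_width (σ : Option ℕ) : 2 ≤ C.width σ := C.two_le.trans (C.h_le_width σ)

theorem width_le (hσ : σ ∈ C.strips) : C.width σ ≤ C.n := by
  cases σ with
  | none => exact C.h_le
  | some j =>
    exact (Nat.le_add_left _ _).trans
      (mul_add_slabHeight_le (lt_of_mem_teeth (some_mem_strips.1 hσ)))

theorem InStrip.slab_eq {j : ℕ} (hv : C.InStrip (some j) a l) : C.slab (C.h * j + a) = j := by
  have hj := lt_of_mem_teeth (some_mem_strips.1 hv.mem_strips)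
  have hn := mul_add_slabHeight_le hj
  have ha : a < C.slabHeight j := hv.lt_width
  exact (slab_eq_iff hj (by omega)).2 ⟨by omega, by omega⟩

theorem InStrip.mul_add_lt {j : ℕ} (hv : C.InStrip (some j) a l) : C.h * j + a < C.n := by
  have hn := mul_add_slabHeight_le (lt_of_mem_teeth (some_mem_strips.1 hv.mem_strips))
  have ha : a < C.slabHeight j := hv.lt_width
  omega

theorem pair_mem_hardPairs (hl : l ∈ C.hardLines σ) : C.pair l ∈ C.hardPairs σ :=
  Finset.mem_image_of_mem _ hl

variable (C σ) in
theorem pair_firstLine_mem_hardPairs : C.pair (C.firstLine σ) ∈ C.hardPairs σ := by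
  cases σ <;> exact pair_mem_hardPairs (by simp [hardLines, firstLine])

variable (C σ) in
theorem pair_last_mem_hardPairs : C.pair (C.n - 1) ∈ C.hardPairs σ := by
  cases σ <;> exact pair_mem_hardPairs (by simp [hardLines])

theorem pair_lt_pair_last (hl : l < C.n) (hs : C.pair l ∉ C.hardPairs σ) :
    C.pair l < C.pair (C.n - 1) := by
  have hne : C.pair l ≠ C.pair (C.n - 1) := fun h => hs (h ▸ C.pair_last_mem_hardPairs σ)
  unfold pair at *
  omega

theorem nextHard_spec (hP : P < C.pair (C.n - 1)) :
    C.nextHard σ P ∈ C.hardPairs σ ∧ P < C.nextHard σ P :=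
  Nat.sInf_mem (s := {Q | Q ∈ C.hardPairs σ ∧ P < Q}) ⟨_, C.pair_last_mem_hardPairs σ, hP⟩

theorem nextHard_le (hQ : Q ∈ C.hardPairs σ) (h : P < Q) : C.nextHard σ P ≤ Q :=
  Nat.sInf_le ⟨hQ, h⟩

theorem nextHard_eq_add_one (h : P + 1 ∈ C.hardPairs σ) : C.nextHard σ P = P + 1 :=
  IsLeast.csInf_eq ⟨⟨h, P.lt_succ_self⟩, fun _ hQ => hQ.2⟩

theorem nextHard_add_one (h : P + 1 ∉ C.hardPairs σ) :
    C.nextHard σ (P + 1) = C.nextHard σ P := by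
  unfold nextHard
  congr! 3 with Q
  refine and_congr_right fun hQ => ?_
  have : Q ≠ P + 1 := ne_of_mem_of_not_mem hQ h
  omega

theorem entry_add_one (h : P + 1 ∉ C.hardPairs σ) : C.entry σ (P + 1) = C.entry σ P := by
  rw [entry, entry, nextHard_add_one h]

theorem nextHard_sub_le (hP : P < C.pair (C.n - 1)) : C.nextHard σ P - P ≤ 2 ^ C.width σ := by
  have hnext := nextHard_le (C.pair_last_mem_hardPairs σ) hP
  have hlast : C.pair (C.n - 1) ≤ C.n := by
    have := C.two_le
    have := C.h_le
    unfold pair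
    omega
  have hn := C.n_le
  have hpow : 2 ^ C.h ≤ 2 ^ C.width σ := Nat.pow_le_pow_right two_pos (C.h_le_width σ)
  omega

theorem endFlag_eq_carryBit (hP : P < C.pair (C.n - 1)) :
    C.endFlag σ P = carryBit (C.counter σ P) (C.width σ) := by
  obtain ⟨hmem, hlt⟩ := nextHard_spec (σ := σ) hP
  rw [endFlag, counter, carryBit_two_pow_sub (by omega) (nextHard_sub_le hP), decide_eq_decide]
  constructor
  · intro h
    rw [nextHard_eq_add_one h, Nat.add_sub_cancel_left]
  · intro h
    rwa [show P + 1 = C.nextHard σ P by omega]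

theorem counter_add_one (hP : P < C.pair (C.n - 1)) (h : P + 1 ∉ C.hardPairs σ) :
    C.counter σ (P + 1) = C.counter σ P + 1 := by
  obtain ⟨hmem, hlt⟩ := nextHard_spec (σ := σ) hP
  have hle := nextHard_sub_le (σ := σ) hP
  have hne : C.nextHard σ P ≠ P + 1 := ne_of_mem_of_not_mem hmem h
  rw [counter, counter, nextHard_add_one h]
  omega

end Strips

section StripLabels

variable (C : Comb) (σ : Option ℕ) (a l : ℕ)

/-- The label between the lines `l - 1` and `l` of a strip. -/
noncomputable def backLabel : Option CombLabel :=
  if C.pair l ∈ C.hardPairs σ then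
    if a = 0 ∧ (σ = none → l ≠ 0) then some (.enter (C.place σ a l)) else none
  else if C.IsReturn l then
    if a + 1 = C.width σ then
      some (.turn σ.isSome ((C.counter σ (C.pair l) + 1).testBit a) (C.endFlag σ (C.pair l)))
    else if a = 0 then
      some (.home σ.isSome (C.entry σ (C.pair l)) ((C.counter σ (C.pair l) + 1).testBit 0))
    else some (.copy σ.isSome ((C.counter σ (C.pair l) + 1).testBit a))
  else if a = 0 then
    some (.start σ.isSome (C.entry σ (C.pair l)) ((C.counter σ (C.pair l)).testBit 0))
  else some (.bit σ.isSome ((C.counter σ (C.pair l)).testBit a) (decide (a + 1 = C.width σ)))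

/-- The label between the positions `a - 1` and `a` of a line. -/
noncomputable def lowLabel : Option CombLabel :=
  if a = 0 then none
  else if C.pair l ∈ C.hardPairs σ then some (.enter (C.place σ a l))
  else if C.IsReturn l then some (.flag σ.isSome (C.endFlag σ (C.pair l)))
  else some (.carry σ.isSome (carryBit (C.counter σ (C.pair l)) a))

/-- The label at the high end of a line. From the spine, it leads into the tooth that starts in
this row, if there is one. -/
noncomputable def outLabel : Option CombLabel :=
  if σ = none ∧ C.h < C.n ∧ C.slab l ∈ C.teeth ∧ C.h * C.slab l = l then
    some (.enter (C.place (some (C.slab l)) 0 C.h))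
  else some (.fill σ.isSome)

/-- The labels of a tile of a strip. For the teeth, they are to be reflected in the diagonal. -/
noncomputable def stripLabel : Dir → Option CombLabel
  | .south => C.backLabel σ a l
  | .north => if l + 1 < C.n then C.backLabel σ a (l + 1) else none
  | .west => C.lowLabel σ a l
  | .east => if a + 1 < C.width σ then C.lowLabel σ (a + 1) l else C.outLabel σ l

/-- The counter tile at a position that is not hard-coded. -/
noncomputable def counterTile : CounterTile :=
  if C.IsReturn l then
    if a + 1 = C.width σ then
      .turn ((C.counter σ (C.pair l) + 1).testBit a) (C.endFlag σ (C.pair l))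
    else if a = 0 then
      .home (C.entry σ (C.pair l)) ((C.counter σ (C.pair l) + 1).testBit 0)
        (C.endFlag σ (C.pair l))
    else .copy ((C.counter σ (C.pair l) + 1).testBit a) (C.endFlag σ (C.pair l))
  else if a = 0 then .lead (C.entry σ (C.pair l)) ((C.counter σ (C.pair l)).testBit 0)
  else
    .add ((C.counter σ (C.pair l)).testBit a) (decide (a + 1 = C.width σ))
      (carryBit (C.counter σ (C.pair l)) a)

variable {C σ a l}

theorem eq_entry_of_mem_target {p : Point} (hp : p ∈ (C.counterTile σ a l).target) :
    p = C.entry σ (C.pair l) := by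
  unfold counterTile at hp
  split_ifs at hp <;> simp_all [CounterTile.target]

theorem outLabel_of_notMem_hardPairs (hs : C.pair l ∉ C.hardPairs σ) :
    C.outLabel σ l = some (.fill σ.isSome) := by
  refine if_neg ?_
  rintro ⟨rfl, -, hslab, hstart⟩
  exact hs (pair_mem_hardPairs
    (Finset.mem_union_left _ (Finset.mem_union_right _ (Finset.mem_image.2 ⟨_, hslab, hstart⟩))))

theorem stripLabel_of_not_isReturn (hv : C.InStrip σ a l) (hs : C.pair l ∉ C.hardPairs σ)
    (hr : ¬ C.IsReturn l) : C.stripLabel σ a l = (C.counterTile σ a l).label σ.isSome := by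
  have hP := pair_lt_pair_last hv.lt_n hs
  have hl : l + 1 < C.n := by unfold pair at hP; omega
  have hpair : C.pair (l + 1) = C.pair l := by unfold pair IsReturn at *; omega
  have hr1 : C.IsReturn (l + 1) := by unfold IsReturn at *; omega
  have hw := hv.lt_width
  funext d
  by_cases ha : a = 0
  · subst ha
    have h1 : 1 < C.width σ := C.two_le_width σ
    cases d <;>
      simp [stripLabel, counterTile, CounterTile.label, backLabel, lowLabel, hl, hpair, hs, hr,
        hr1, h1, h1.ne, testBit_add_one, carryBit_zero, carryBit_add_one]
  · by_cases hlast : a + 1 = C.width σ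
    · have hflag : C.endFlag σ (C.pair l) =
          ((C.counter σ (C.pair l)).testBit a && carryBit (C.counter σ (C.pair l)) a) := by
        rw [endFlag_eq_carryBit hP, ← hlast, carryBit_add_one]
      cases d <;>
        simp [stripLabel, counterTile, CounterTile.label, backLabel, lowLabel, hl, hpair, hs, hr,
          hr1, ha, hlast, outLabel_of_notMem_hardPairs hs, testBit_add_one, hflag]
    · have hlt : a + 1 < C.width σ := by omega
      cases d <;>
        simp [stripLabel, counterTile, CounterTile.label, backLabel, lowLabel, hl, hpair, hs, hr,
          hr1, ha, hlast, hlt, testBit_add_one, carryBit_add_one]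

theorem stripLabel_north_of_isReturn (hl : l < C.n) (hs : C.pair l ∉ C.hardPairs σ)
    (hr : C.IsReturn l) :
    C.stripLabel σ a l .north =
      if C.endFlag σ (C.pair l) then
        if a = 0 then some (.enter (C.entry σ (C.pair l))) else none
      else if a = 0 then
        some (.start σ.isSome (C.entry σ (C.pair l)) ((C.counter σ (C.pair l) + 1).testBit 0))
      else
        some (.bit σ.isSome ((C.counter σ (C.pair l) + 1).testBit a)
          (decide (a + 1 = C.width σ))) := by
  have hP := pair_lt_pair_last hl hs
  have hl1 : l + 1 < C.n := by unfold pair at hP; omega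
  have hpair : C.pair (l + 1) = C.pair l + 1 := by unfold pair IsReturn at *; omega
  have hr1 : ¬ C.IsReturn (l + 1) := by unfold IsReturn at *; omega
  by_cases h : C.pair l + 1 ∈ C.hardPairs σ
  · have hline : 2 * (C.pair l + 1) - C.n % 2 = l + 1 := by unfold pair IsReturn at *; omega
    by_cases ha : a = 0 <;>
      simp [stripLabel, backLabel, endFlag, h, hl1, hpair, entry, nextHard_eq_add_one h, hline, ha]
  · by_cases ha : a = 0 <;>
      simp [stripLabel, backLabel, endFlag, h, hl1, hpair, counter_add_one hP h, entry_add_one h,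
        hr1, ha]

theorem stripLabel_of_isReturn (hv : C.InStrip σ a l) (hs : C.pair l ∉ C.hardPairs σ)
    (hr : C.IsReturn l) : C.stripLabel σ a l = (C.counterTile σ a l).label σ.isSome := by
  have hnorth := stripLabel_north_of_isReturn (a := a) hv.lt_n hs hr
  have hout := outLabel_of_notMem_hardPairs hs
  have hw := hv.lt_width
  have hw2 := C.two_le_width σ
  funext d
  by_cases hlast : a + 1 = C.width σ
  · have ha : a ≠ 0 := by omega
    cases d with
    | north => simp [hnorth, counterTile, CounterTile.label, hr, hlast, ha]
    | _ => simp [stripLabel, counterTile, CounterTile.label, backLabel, lowLabel, hout, hs, hr,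
        hlast, ha]
  · have hlt : a + 1 < C.width σ := by omega
    cases d with
    | north => by_cases ha : a = 0 <;> simp_all [counterTile, CounterTile.label]
    | _ => by_cases ha : a = 0 <;>
        simp_all [stripLabel, counterTile, CounterTile.label, backLabel, lowLabel]

theorem stripLabel_eq_label_counterTile (hv : C.InStrip σ a l) (hs : C.pair l ∉ C.hardPairs σ) :
    C.stripLabel σ a l = (C.counterTile σ a l).label σ.isSome := by
  by_cases hr : C.IsReturn l
  · exact stripLabel_of_isReturn hv hs hr
  · exact stripLabel_of_not_isReturn hv hs hr

end StripLabels

section Layout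

variable (C : Comb)

/-- The strip, the position and the line of a location, if it belongs to the comb. -/
def locate (p : Point) : Option (Option ℕ × ℕ × ℕ) :=
  if p.1 < C.h then some (none, p.1.toNat, p.2.toNat)
  else if C.slab p.2.toNat ∈ C.teeth then
    some (some (C.slab p.2.toNat), p.2.toNat - C.h * C.slab p.2.toNat, p.1.toNat)
  else none

/-- The labels of the tile that fills the square outside the comb. -/
def fillLabel : Dir → Option CombLabel
  | .north => some (.fill true)
  | .south => some (.fill true)
  | .east => some (.fill false)
  | .west => some (.fill false)

/-- The labels of the tile at a location. -/
noncomputable def label (p : Point) : Dir → Option CombLabel :=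
  match C.locate p with
  | some (σ, a, l) => C.stripLabel σ a l ∘ Dir.reflect σ.isSome
  | none => fillLabel

/-- The lines of a strip that are assembled from the high to the low end. -/
def IsReversed (σ : Option ℕ) (l : ℕ) : Prop := C.pair l ∉ C.hardPairs σ ∧ C.IsReturn l

/-- The order of assembly inside a strip. -/
noncomputable def stripRank (σ : Option ℕ) (a l : ℕ) : ℕ :=
  l * (C.n + 1) + if C.IsReversed σ l then C.width σ - a else a

/-- An order of assembly: first the spine, then the teeth, and finally the other locations. -/
noncomputable def rank (p : Point) : ℕ :=
  match C.locate p with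
  | some (σ, a, l) => (if σ.isSome then (C.n + 1) ^ 2 else 0) + C.stripRank σ a l
  | none => 2 * (C.n + 1) ^ 2 + p.1.toNat + p.2.toNat

/-- The locations of the square. -/
noncomputable def region : Finset Point := Finset.Ico 0 (C.n : ℤ) ×ˢ Finset.Ico 0 (C.n : ℤ)

/-- The locations of the square that are outside the comb. -/
structure IsFill (p : Point) : Prop where
  mem_region : p ∈ C.region
  h_le : C.h ≤ p.1
  slab_notMem : C.slab p.2.toNat ∉ C.teeth

variable {C} {σ : Option ℕ} {a a' l l' x y : ℕ} {p : Point}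

theorem mem_region : p ∈ C.region ↔ p ∈ square C.n := by
  simp [region, square, and_assoc]

theorem mk_mem_region : (((x : ℤ), (y : ℤ)) : Point) ∈ C.region ↔ x < C.n ∧ y < C.n := by
  simp [region]

theorem exists_of_mem_region (hp : p ∈ C.region) :
    ∃ x y : ℕ, p = ((x : ℤ), (y : ℤ)) ∧ x < C.n ∧ y < C.n := by
  obtain ⟨hx, hx', hy, hy'⟩ := mem_region.1 hp
  exact ⟨p.1.toNat, p.2.toNat, Prod.ext (Int.toNat_of_nonneg hx).symm (Int.toNat_of_nonneg hy).symm,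
    by omega, by omega⟩

theorem isFill_mk :
    C.IsFill ((x : ℤ), (y : ℤ)) ↔ (x < C.n ∧ y < C.n) ∧ C.h ≤ x ∧ C.slab y ∉ C.teeth := by
  constructor
  · rintro ⟨h, hx, hy⟩
    exact ⟨mk_mem_region.1 h, by simpa using hx, hy⟩
  · rintro ⟨h, hx, hy⟩
    exact ⟨mk_mem_region.2 h, by simpa using hx, hy⟩

theorem InStrip.locate_place (hv : C.InStrip σ a l) :
    C.locate (C.place σ a l) = some (σ, a, l) := by
  cases σ with
  | none =>
    have : a < C.h := hv.lt_width
    simp [locate, place, this]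
  | some j =>
    have hl : ¬ l < C.h := not_lt.2 hv.firstLine_le
    have hcast : ((C.h : ℤ) * j + a).toNat = C.h * j + a := by norm_cast
    simp [locate, place, hl, hcast, hv.slab_eq, some_mem_strips.1 hv.mem_strips]

theorem IsFill.locate_eq_none (h : C.IsFill p) : C.locate p = none := by
  simp [locate, h.h_le.not_gt, h.slab_notMem]

theorem InStrip.place_mem_region (hv : C.InStrip σ a l) : C.place σ a l ∈ C.region := by
  cases σ with
  | none => exact mk_mem_region.2 ⟨hv.lt_width.trans_le C.h_le, hv.lt_n⟩
  | some j =>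
    have := mk_mem_region.2 ⟨hv.lt_n, hv.mul_add_lt⟩
    push_cast at this
    exact this

theorem InStrip.label_place (hv : C.InStrip σ a l) :
    C.label (C.place σ a l) = C.stripLabel σ a l ∘ Dir.reflect σ.isSome := by
  rw [label, hv.locate_place]

theorem InStrip.rank_place (hv : C.InStrip σ a l) :
    C.rank (C.place σ a l) = (if σ.isSome then (C.n + 1) ^ 2 else 0) + C.stripRank σ a l := by
  rw [rank, hv.locate_place]

theorem IsFill.label_eq (h : C.IsFill p) : C.label p = fillLabel := by
  rw [label, h.locate_eq_none]

theorem IsFill.rank_eq (h : C.IsFill p) :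
    C.rank p = 2 * (C.n + 1) ^ 2 + p.1.toNat + p.2.toNat := by
  rw [rank, h.locate_eq_none]

theorem inStrip_tooth (hx : C.h ≤ x) (hxn : x < C.n) (hy : y < C.n) (hj : C.slab y ∈ C.teeth) :
    C.InStrip (some (C.slab y)) (y - C.h * C.slab y) x where
  mem_strips := some_mem_strips.2 hj
  lt_width := by
    have hle := mul_slab_le hy
    have hlt := lt_mul_slab_add hy
    change _ < C.slabHeight _
    omega
  firstLine_le := hx
  lt_n := hxn

theorem place_tooth (hy : y < C.n) :
    C.place (some (C.slab y)) (y - C.h * C.slab y) x = ((x : ℤ), (y : ℤ)) := by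
  simp only [place, Prod.mk.injEq, true_and]
  push_cast [mul_slab_le hy]
  ring

theorem exists_inStrip_or_isFill (hp : p ∈ C.region) :
    (∃ σ a l, C.InStrip σ a l ∧ p = C.place σ a l) ∨ C.IsFill p := by
  obtain ⟨x, y, rfl, hx, hy⟩ := exists_of_mem_region hp
  by_cases h : x < C.h
  · exact Or.inl ⟨none, x, y, ⟨Finset.none_mem_insertNone, h, Nat.zero_le _, hy⟩, rfl⟩
  · by_cases hj : C.slab y ∈ C.teeth
    · exact Or.inl ⟨_, _, _, inStrip_tooth (not_lt.1 h) hx hy hj, (place_tooth hy).symm⟩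
    · exact Or.inr (isFill_mk.2 ⟨⟨hx, hy⟩, not_lt.1 h, hj⟩)

theorem InStrip.stripRank_lt (hv : C.InStrip σ a l) :
    C.stripRank σ a l < (l + 1) * (C.n + 1) := by
  have hw := hv.lt_width
  have hn := width_le hv.mem_strips
  rw [add_one_mul]
  unfold stripRank
  split_ifs <;> omega

theorem InStrip.rank_place_lt (hv : C.InStrip σ a l) :
    C.rank (C.place σ a l) < (if σ.isSome then 2 else 1) * (C.n + 1) ^ 2 := by
  have hlt := hv.stripRank_lt
  have hle : (l + 1) * (C.n + 1) ≤ (C.n + 1) ^ 2 := by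
    rw [sq]
    exact Nat.mul_le_mul_right _ (by have := hv.lt_n; omega)
  rw [hv.rank_place]
  split_ifs <;> omega

theorem IsFill.rank_lt {q : Point} (h : C.IsFill p) (hq : q ∈ C.region)
    (hqp : q.1 + q.2 < p.1 + p.2) : C.rank q < C.rank p := by
  obtain ⟨hx, -, hy, -⟩ := Comb.mem_region.1 h.mem_region
  obtain ⟨hx', -, hy', -⟩ := Comb.mem_region.1 hq
  rw [h.rank_eq]
  obtain ⟨σ, a, l, hv, rfl⟩ | hq := exists_inStrip_or_isFill hq
  · have hlt := hv.rank_place_lt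
    have hle : (if σ.isSome then 2 else 1) * (C.n + 1) ^ 2 ≤ 2 * (C.n + 1) ^ 2 :=
      Nat.mul_le_mul_right _ (by split_ifs <;> omega)
    omega
  · rw [hq.rank_eq]
    omega

theorem place_add_north : C.place σ a l + (Dir.reflect σ.isSome .north).vec =
    C.place σ a (l + 1) := by
  cases σ <;> simp [place, Dir.reflect, Dir.vec]

theorem place_add_south : C.place σ a (l + 1) + (Dir.reflect σ.isSome .south).vec =
    C.place σ a l := by
  cases σ <;> simp [place, Dir.reflect, Dir.vec]

theorem place_add_east : C.place σ a l + (Dir.reflect σ.isSome .east).vec =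
    C.place σ (a + 1) l := by
  cases σ <;> simp [place, Dir.reflect, Dir.vec, add_assoc]

theorem place_add_west : C.place σ (a + 1) l + (Dir.reflect σ.isSome .west).vec =
    C.place σ a l := by
  cases σ <;> simp [place, Dir.reflect, Dir.vec, add_assoc]

theorem InStrip.of_line (hv : C.InStrip σ a l) (hle : C.firstLine σ ≤ l') (hlt : l' < C.n) :
    C.InStrip σ a l' := ⟨hv.mem_strips, hv.lt_width, hle, hlt⟩

theorem InStrip.of_position (hv : C.InStrip σ a l) (ha : a' < C.width σ) : C.InStrip σ a' l :=
  ⟨hv.mem_strips, ha, hv.firstLine_le, hv.lt_n⟩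

end Layout

section Matching

variable (C : Comb)

/-- The neighbour in direction `d` of the tile at `p` also has the label `b` on the common side,
and it precedes `p` in the order of assembly if `b` is an input of the tile at `p`. -/
structure Matched (p : Point) (d : Dir) (b : CombLabel) : Prop where
  mem_region : p + d.vec ∈ C.region
  label_eq : C.label (p + d.vec) d.opp = some b
  rank_lt : b.IsInput d → C.rank (p + d.vec) < C.rank p

variable {C} {σ : Option ℕ} {a a' l l' j x y : ℕ} {p : Point} {d : Dir} {b : CombLabel}

theorem InStrip.matched (hv : C.InStrip σ a l) (hv' : C.InStrip σ a' l')
    (hp : C.place σ a l + (Dir.reflect σ.isSome d).vec = C.place σ a' l')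
    (hb : C.stripLabel σ a' l' d.opp = some b)
    (hrank : b.IsInput d → C.stripRank σ a' l' < C.stripRank σ a l) :
    C.Matched (C.place σ a l) (Dir.reflect σ.isSome d) b where
  mem_region := hp ▸ hv'.place_mem_region
  label_eq := by
    rw [hp, hv'.label_place, Function.comp_apply, Dir.opp_reflect, Dir.reflect_reflect, hb]
  rank_lt hin := by
    rw [hp, hv.rank_place, hv'.rank_place]
    exact Nat.add_lt_add_left (hrank ((CombLabel.isInput_reflect _ _ _).1 hin)) _

theorem isInput_of_backLabel (h : C.backLabel σ a l = some b) : b.IsInput d ↔ d.isLow = true := by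
  unfold backLabel at h
  split_ifs at h <;> cases h <;> rfl

theorem isInput_of_outLabel (h : C.outLabel σ l = some b) : b.IsInput d ↔ d.isLow = true := by
  unfold outLabel at h
  split_ifs at h <;> cases h <;> rfl

theorem isInput_of_lowLabel (h : C.lowLabel σ a l = some b) :
    b.IsInput d ↔ (d.isLow = true ↔ ¬ C.IsReversed σ l) := by
  unfold lowLabel at h
  split_ifs at h <;> cases h <;> simp_all [CombLabel.IsInput, IsReversed]

theorem place_exit_add_east :
    C.place none (C.h - 1) (C.h * j) + Dir.east.vec = C.place (some j) 0 C.h := by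
  have := C.two_le
  simp only [place, Dir.vec, Prod.mk_add_mk, Prod.mk.injEq]
  push_cast
  omega

theorem inStrip_entrance (hj : j ∈ C.teeth) (hn : C.h < C.n) : C.InStrip (some j) 0 C.h :=
  ⟨some_mem_strips.2 hj, by have := C.two_le_width (some j); omega, le_rfl, hn⟩

theorem inStrip_exit (hj : j ∈ C.teeth) : C.InStrip none (C.h - 1) (C.h * j) where
  mem_strips := Finset.none_mem_insertNone
  lt_width := Nat.sub_lt (by have := C.two_le; omega) one_pos
  firstLine_le := Nat.zero_le _
  lt_n := by
    have := mul_add_slabHeight_le (lt_of_mem_teeth hj)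
    have := C.h_le_slabHeight j
    have := C.two_le
    omega

theorem slab_mul (hj : j ∈ C.teeth) : C.slab (C.h * j) = j :=
  (slab_eq_iff (lt_of_mem_teeth hj) (inStrip_exit hj).lt_n).2
    ⟨le_rfl, by have := C.two_le_width (some j); simp only [width] at this; omega⟩

theorem label_exit (hj : j ∈ C.teeth) (hn : C.h < C.n) :
    C.label (C.place none (C.h - 1) (C.h * j)) .east = some (.enter (C.place (some j) 0 C.h)) := by
  have hw : ¬ C.h - 1 + 1 < C.width none := by simp only [width]; omega
  rw [(inStrip_exit hj).label_place]
  simp [Dir.reflect, stripLabel, hw, outLabel, slab_mul hj, hj, hn]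

theorem label_entrance (hj : j ∈ C.teeth) (hn : C.h < C.n) :
    C.label (C.place (some j) 0 C.h) .west = some (.enter (C.place (some j) 0 C.h)) := by
  have hhard : C.pair C.h ∈ C.hardPairs (some j) := C.pair_firstLine_mem_hardPairs (some j)
  rw [(inStrip_entrance hj hn).label_place]
  simp [Dir.reflect, stripLabel, backLabel, hhard]

theorem matched_exit (hj : j ∈ C.teeth) (hn : C.h < C.n) :
    C.Matched (C.place none (C.h - 1) (C.h * j)) .east (.enter (C.place (some j) 0 C.h)) where
  mem_region := place_exit_add_east ▸ (inStrip_entrance hj hn).place_mem_region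
  label_eq := place_exit_add_east ▸ label_entrance hj hn
  rank_lt h := absurd h (by simp [CombLabel.IsInput, Dir.isLow])

theorem matched_entrance (hj : j ∈ C.teeth) (hn : C.h < C.n) :
    C.Matched (C.place (some j) 0 C.h) .west (.enter (C.place (some j) 0 C.h)) := by
  have hp : C.place (some j) 0 C.h + Dir.west.vec = C.place none (C.h - 1) (C.h * j) := by
    rw [← place_exit_add_east]
    exact Dir.add_vec_add_opp_vec _ Dir.east
  have hx := inStrip_exit hj
  refine ⟨hp ▸ hx.place_mem_region, hp ▸ label_exit hj hn, fun _ => ?_⟩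
  have hlt := hx.rank_place_lt
  rw [hp, (inStrip_entrance hj hn).rank_place]
  simp only [Option.isSome_none, Option.isSome_some, if_true, Bool.false_eq_true, if_false,
    one_mul] at hlt ⊢
  omega

theorem InStrip.matched_south (hv : C.InStrip σ a l) (hb : C.stripLabel σ a l .south = some b) :
    C.Matched (C.place σ a l) (Dir.reflect σ.isSome .south) b := by
  simp only [stripLabel] at hb
  by_cases hl : l = C.firstLine σ
  · have hhard : C.pair l ∈ C.hardPairs σ := hl ▸ C.pair_firstLine_mem_hardPairs σ
    rw [backLabel, if_pos hhard] at hb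
    split_ifs at hb with h
    cases hb
    obtain ⟨rfl, hne⟩ := h
    cases σ with
    | none => exact absurd hl (hne rfl)
    | some j =>
      obtain rfl : l = C.h := hl
      exact matched_entrance (some_mem_strips.1 hv.mem_strips) hv.lt_n
  · obtain ⟨k, rfl⟩ : ∃ k, l = k + 1 := ⟨l - 1, by have := hv.firstLine_le; omega⟩
    have hlt := hv.lt_n
    have hle := hv.firstLine_le
    have hv' : C.InStrip σ a k := hv.of_line (by omega) (by omega)
    exact hv.matched hv' place_add_south (by simpa [Dir.opp, stripLabel, hlt] using hb)
      fun _ => hv'.stripRank_lt.trans_le (Nat.le_add_right _ _)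

theorem InStrip.matched_west (hv : C.InStrip σ a l) (hb : C.stripLabel σ a l .west = some b) :
    C.Matched (C.place σ a l) (Dir.reflect σ.isSome .west) b := by
  simp only [stripLabel] at hb
  have ha : a ≠ 0 := by
    rintro rfl
    simp [lowLabel] at hb
  obtain ⟨k, rfl⟩ := Nat.exists_eq_succ_of_ne_zero ha
  have hw := hv.lt_width
  refine hv.matched (hv.of_position (Nat.lt_of_succ_lt hw)) place_add_west
    (by simpa [Dir.opp, stripLabel, hw] using hb) fun hin => ?_
  have hrev : ¬ C.IsReversed σ l := ((isInput_of_lowLabel hb).1 hin).1 rfl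
  simp [stripRank, hrev]

theorem InStrip.matched_east (hv : C.InStrip σ a l) (hb : C.stripLabel σ a l .east = some b)
    (h : b.IsInput .east ∨ ∀ o, b ≠ .fill o) :
    C.Matched (C.place σ a l) (Dir.reflect σ.isSome .east) b := by
  simp only [stripLabel] at hb
  split_ifs at hb with hw
  · refine hv.matched (hv.of_position hw) place_add_east hb fun hin => ?_
    have hrev : C.IsReversed σ l := by
      simpa [Dir.isLow] using (isInput_of_lowLabel hb).1 hin
    simp only [stripRank, hrev, if_true]
    omega
  · have hne := h.resolve_left fun hin => Bool.false_ne_true ((isInput_of_outLabel hb).1 hin)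
    unfold outLabel at hb
    split_ifs at hb with hout
    · obtain ⟨rfl, hn, hj, hl⟩ := hout
      cases hb
      have ha : a = C.h - 1 := by
        have := hv.lt_width
        simp only [width] at this hw
        omega
      have := matched_exit hj hn
      rwa [hl, ← ha] at this
    · exact absurd (Option.some.inj hb).symm (hne _)

theorem InStrip.matched_stripLabel (hv : C.InStrip σ a l) (hb : C.stripLabel σ a l d = some b)
    (h : b.IsInput d ∨ ∀ o, b ≠ .fill o) :
    C.Matched (C.place σ a l) (Dir.reflect σ.isSome d) b := by
  cases d with
  | north =>
    simp only [stripLabel] at hb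
    split_ifs at hb with hl
    exact hv.matched (hv.of_line (hv.firstLine_le.trans l.le_succ) hl) place_add_north hb
      fun hin => absurd ((isInput_of_backLabel hb).1 hin) Bool.false_ne_true
  | east => exact hv.matched_east hb h
  | south => exact hv.matched_south hb
  | west => exact hv.matched_west hb

theorem backLabel_ne_fill {o : Bool} : C.backLabel σ a l ≠ some (.fill o) := by
  unfold backLabel
  split_ifs <;> simp

theorem lowLabel_ne_fill {o : Bool} : C.lowLabel σ a l ≠ some (.fill o) := by
  unfold lowLabel
  split_ifs <;> simp

theorem label_north_eq_fill_iff (hx : C.h ≤ x) (hxn : x < C.n) (hy : y < C.n) :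
    C.label ((x : ℤ), (y : ℤ)) .north = some (.fill true) ↔
      C.slab y ∉ C.teeth ∨ y + 1 = C.h * C.slab y + C.slabHeight (C.slab y) := by
  by_cases hj : C.slab y ∈ C.teeth
  · have hle := mul_slab_le hy
    have hlt := lt_mul_slab_add hy
    rw [← place_tooth hy, (inStrip_tooth hx hxn hy hj).label_place]
    simp only [Option.isSome_some, Function.comp_apply, Dir.reflect, stripLabel, hj,
      not_true_eq_false, false_or]
    split_ifs with hw <;> simp only [width] at hw
    · exact iff_of_false lowLabel_ne_fill (by omega)
    · exact iff_of_true (by simp [outLabel]) (by omega)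
  · have hf : C.IsFill ((x : ℤ), (y : ℤ)) := isFill_mk.2 ⟨⟨hxn, hy⟩, hx, hj⟩
    exact iff_of_true (congrFun hf.label_eq _) (Or.inl hj)

theorem label_east_eq_fill_iff_of_lt (hx : x < C.h) (hy : y < C.n) :
    C.label ((x : ℤ), (y : ℤ)) .east = some (.fill false) ↔
      x + 1 = C.h ∧ ¬ (C.h < C.n ∧ C.slab y ∈ C.teeth ∧ C.h * C.slab y = y) := by
  have hv : C.InStrip none x y := ⟨Finset.none_mem_insertNone, hx, Nat.zero_le _, hy⟩
  change C.label (C.place none x y) .east = _ ↔ _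
  rw [hv.label_place]
  simp only [Option.isSome_none, Function.comp_apply, Dir.reflect, stripLabel]
  split_ifs with hw <;> simp only [width] at hw
  · exact iff_of_false lowLabel_ne_fill (by omega)
  · unfold outLabel
    split_ifs with hout
    · exact iff_of_false (by simp) fun h => h.2 hout.2
    · exact iff_of_true rfl ⟨by omega, fun h => hout ⟨rfl, h⟩⟩

theorem label_east_eq_fill_iff_of_le (hx : C.h ≤ x) (hxn : x < C.n) (hy : y < C.n) :
    C.label ((x : ℤ), (y : ℤ)) .east = some (.fill false) ↔ C.slab y ∉ C.teeth := by
  by_cases hj : C.slab y ∈ C.teeth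
  · rw [← place_tooth hy, (inStrip_tooth hx hxn hy hj).label_place]
    simp only [Option.isSome_some, Function.comp_apply, Dir.reflect, stripLabel]
    split_ifs
    · exact iff_of_false backLabel_ne_fill (not_not.2 hj)
    · exact iff_of_false nofun (not_not.2 hj)
  · have hf : C.IsFill ((x : ℤ), (y : ℤ)) := isFill_mk.2 ⟨⟨hxn, hy⟩, hx, hj⟩
    exact iff_of_true (congrFun hf.label_eq _) hj

theorem IsFill.exists_eq (h : C.IsFill p) :
    ∃ x y : ℕ, p = (((x + 1 : ℕ) : ℤ), ((y + 1 : ℕ) : ℤ)) := by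
  obtain ⟨x, y, rfl, -, -⟩ := exists_of_mem_region h.mem_region
  obtain ⟨-, hx, hj⟩ := isFill_mk.1 h
  have hx0 : x ≠ 0 := by have := C.two_le; omega
  have hy0 : y ≠ 0 := by
    rintro rfl
    exact hj (by simp [slab, teeth])
  obtain ⟨k, rfl⟩ := Nat.exists_eq_succ_of_ne_zero hx0
  obtain ⟨m, rfl⟩ := Nat.exists_eq_succ_of_ne_zero hy0
  exact ⟨k, m, rfl⟩

theorem add_south_vec :
    (((x : ℤ), ((y + 1 : ℕ) : ℤ)) : Point) + Dir.south.vec = ((x : ℤ), (y : ℤ)) := by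
  simp [Dir.vec]

theorem add_west_vec :
    ((((x + 1 : ℕ) : ℤ), (y : ℤ)) : Point) + Dir.west.vec = ((x : ℤ), (y : ℤ)) := by
  simp [Dir.vec]

theorem IsFill.matched_south (h : C.IsFill p) : C.Matched p .south (.fill true) := by
  obtain ⟨x, y, rfl⟩ := h.exists_eq
  obtain ⟨⟨hxn, hyn⟩, hx, hj⟩ := isFill_mk.1 h
  have hmem : (((x + 1 : ℕ) : ℤ), (y : ℤ)) ∈ C.region :=
    mk_mem_region.2 ⟨hxn, Nat.lt_of_succ_lt hyn⟩
  have hlabel := (label_north_eq_fill_iff hx hxn (Nat.lt_of_succ_lt hyn)).2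
    ((slab_add_one hyn).elim (fun hslab => Or.inl (hslab ▸ hj)) fun hend => Or.inr hend.2)
  constructor <;> rw [add_south_vec]
  exacts [hmem, hlabel, fun _ => h.rank_lt hmem (by simp)]

theorem IsFill.matched_west (h : C.IsFill p) : C.Matched p .west (.fill false) := by
  obtain ⟨x, y, rfl⟩ := h.exists_eq
  obtain ⟨⟨hxn, hyn⟩, hx, hj⟩ := isFill_mk.1 h
  have hmem : ((x : ℤ), ((y + 1 : ℕ) : ℤ)) ∈ C.region :=
    mk_mem_region.2 ⟨Nat.lt_of_succ_lt hxn, hyn⟩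
  have hlabel : C.label ((x : ℤ), ((y + 1 : ℕ) : ℤ)) .east = some (.fill false) := by
    obtain hx' | hx' := lt_or_ge x C.h
    · exact (label_east_eq_fill_iff_of_lt hx' hyn).2 ⟨by omega, fun h => hj h.2.1⟩
    · exact (label_east_eq_fill_iff_of_le hx' (Nat.lt_of_succ_lt hxn) hyn).2 hj
  constructor <;> rw [add_west_vec]
  exacts [hmem, hlabel, fun _ => h.rank_lt hmem (by simp)]

theorem matched_of_label_eq (hp : p ∈ C.region) (hb : C.label p d = some b)
    (h : b.IsInput d ∨ ∀ o, b ≠ .fill o) : C.Matched p d b := by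
  obtain ⟨σ, a, l, hv, rfl⟩ | hf := exists_inStrip_or_isFill hp
  · rw [hv.label_place] at hb
    simpa using hv.matched_stripLabel hb (h.imp (CombLabel.isInput_reflect _ _ _).2 id)
  · rw [hf.label_eq] at hb
    cases d <;> obtain rfl := Option.some.inj hb
    case south => exact hf.matched_south
    case west => exact hf.matched_west
    all_goals exact absurd h (by simp [CombLabel.IsInput, Dir.isLow])

theorem isFill_of_label_eq_fill (hs : p + Dir.south.vec ∈ C.region)
    (hs' : C.label (p + Dir.south.vec) .north = some (.fill true))
    (hw : p + Dir.west.vec ∈ C.region)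
    (hw' : C.label (p + Dir.west.vec) .east = some (.fill false)) : C.IsFill p := by
  obtain ⟨p, q⟩ := p
  have hps := mem_region.1 hs
  have hpw := mem_region.1 hw
  simp only [square, Dir.vec, Prod.mk_add_mk, Set.mem_ofPred_eq] at hps hpw
  obtain ⟨x, rfl⟩ : ∃ x : ℕ, p = ((x + 1 : ℕ) : ℤ) := ⟨(p - 1).toNat, by omega⟩
  obtain ⟨y, rfl⟩ : ∃ y : ℕ, q = ((y + 1 : ℕ) : ℤ) := ⟨(q - 1).toNat, by omega⟩
  have hxn : x + 1 < C.n := by omega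
  have hyn : y + 1 < C.n := by omega
  rw [add_south_vec] at hs'
  rw [add_west_vec] at hw'
  obtain hx | hx := lt_or_ge x C.h
  · obtain ⟨hxh, hstart⟩ := (label_east_eq_fill_iff_of_lt hx hyn).1 hw'
    refine isFill_mk.2 ⟨⟨hxn, hyn⟩, hxh.ge, fun hj => hstart ⟨hxh ▸ hxn, hj, ?_⟩⟩
    obtain hslab | ⟨hslab, -⟩ := slab_add_one hyn
    · have hlt := lt_mul_slab_add hyn
      rw [hslab] at hj hlt
      have := ((label_north_eq_fill_iff hxh.ge hxn (Nat.lt_of_succ_lt hyn)).1 hs').resolve_left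
        (not_not.2 hj)
      omega
    · exact hslab.symm
  · exact isFill_mk.2 ⟨⟨hxn, hyn⟩, hx.trans x.le_succ,
      (label_east_eq_fill_iff_of_le hx (Nat.lt_of_succ_lt hxn) hyn).1 hw'⟩

end Matching

section Determination

variable (C : Comb)

/-- The kind of the tile at a location. -/
noncomputable def kind (p : Point) : Kind :=
  match C.locate p with
  | some (σ, a, l) =>
    if C.pair l ∈ C.hardPairs σ then .hard p else .counter σ.isSome (C.counterTile σ a l)
  | none => .fill

/-- The labels of the tiles of a kind. -/
noncomputable def kindLabel : Kind → Dir → Option CombLabel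
  | .hard p => C.label p
  | .counter o s => s.label o ∘ Dir.reflect o
  | .fill => fillLabel

/-- The hard-coded locations. -/
def IsHard (p : Point) : Prop :=
  ∃ σ a l, C.InStrip σ a l ∧ C.pair l ∈ C.hardPairs σ ∧ p = C.place σ a l

variable {C} {σ : Option ℕ} {a l : ℕ} {p r : Point} {d : Dir} {b : CombLabel}

theorem IsHard.kind_eq (hp : C.IsHard p) : C.kind p = .hard p := by
  obtain ⟨σ, a, l, hv, hh, rfl⟩ := hp
  rw [kind, hv.locate_place]
  exact if_pos hh

theorem InStrip.kind_place (hv : C.InStrip σ a l) (hs : C.pair l ∉ C.hardPairs σ) :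
    C.kind (C.place σ a l) = .counter σ.isSome (C.counterTile σ a l) := by
  rw [kind, hv.locate_place]
  exact if_neg hs

theorem InStrip.label_place_of_notMem (hv : C.InStrip σ a l) (hs : C.pair l ∉ C.hardPairs σ) :
    C.label (C.place σ a l) =
      (C.counterTile σ a l).label σ.isSome ∘ Dir.reflect σ.isSome := by
  rw [hv.label_place, stripLabel_eq_label_counterTile hv hs]

theorem IsFill.kind_eq (hp : C.IsFill p) : C.kind p = .fill := by
  rw [kind, hp.locate_eq_none]

theorem isHard_or_counter_or_isFill (hp : p ∈ C.region) : C.IsHard p ∨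
    (∃ σ a l, C.InStrip σ a l ∧ C.pair l ∉ C.hardPairs σ ∧ p = C.place σ a l) ∨ C.IsFill p := by
  obtain ⟨σ, a, l, hv, rfl⟩ | hf := exists_inStrip_or_isFill hp
  · by_cases hh : C.pair l ∈ C.hardPairs σ
    · exact Or.inl ⟨σ, a, l, hv, hh, rfl⟩
    · exact Or.inr (Or.inl ⟨σ, a, l, hv, hh, rfl⟩)
  · exact Or.inr (Or.inr hf)

theorem label_eq_kindLabel (hp : p ∈ C.region) : C.label p = C.kindLabel (C.kind p) := by
  obtain hh | ⟨σ, a, l, hv, hs, rfl⟩ | hf := isHard_or_counter_or_isFill hp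
  · rw [hh.kind_eq, kindLabel]
  · rw [hv.kind_place hs, kindLabel, hv.label_place_of_notMem hs]
  · rw [hf.kind_eq, kindLabel, hf.label_eq]

theorem InStrip.place_eq_zero_iff (hv : C.InStrip σ a l) :
    C.place σ a l = 0 ↔ σ = none ∧ a = 0 ∧ l = 0 := by
  cases σ with
  | none => simp [place, Prod.ext_iff]
  | some j =>
    have hh := C.two_le
    have hl : C.h ≤ l := hv.firstLine_le
    simp only [place, Prod.ext_iff, Prod.fst_zero, Prod.snd_zero, reduceCtorEq, false_and,
      iff_false]
    omega

theorem InStrip.isInputOf_stripLabel_iff (hv : C.InStrip σ a l) (hh : C.pair l ∈ C.hardPairs σ) :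
    CombLabel.system.IsInputOf (C.stripLabel σ a l) d b ↔ C.place σ a l ≠ 0 ∧
      d = (if a = 0 then .south else .west) ∧ b = .enter (C.place σ a l) := by
  rw [Ne, hv.place_eq_zero_iff]
  cases d with
  | north =>
    refine iff_of_false ?_ (by split_ifs <;> simp)
    rintro ⟨hb, hin⟩
    simp only [stripLabel] at hb
    split_ifs at hb
    exact Bool.false_ne_true ((isInput_of_backLabel hb).1 hin)
  | south =>
    simp only [LabelSystem.IsInputOf, CombLabel.system, stripLabel, backLabel, if_pos hh]
    grind [CombLabel.IsInput, Dir.isLow]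
  | west =>
    simp only [LabelSystem.IsInputOf, CombLabel.system, stripLabel, lowLabel, if_pos hh]
    grind [CombLabel.IsInput, Dir.isLow]
  | east =>
    refine iff_of_false ?_ (by split_ifs <;> simp)
    rintro ⟨hb, hin⟩
    simp only [stripLabel] at hb
    split_ifs at hb
    · exact ((isInput_of_lowLabel hb).1 hin).not.1 Bool.false_ne_true fun h => h.1 hh
    · exact Bool.false_ne_true ((isInput_of_outLabel hb).1 hin)

theorem IsHard.exists_isInputOf_label_iff (hp : C.IsHard p) : ∃ d₀, ∀ d b,
    CombLabel.system.IsInputOf (C.label p) d b ↔ p ≠ 0 ∧ d = d₀ ∧ b = .enter p := by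
  obtain ⟨σ, a, l, hv, hh, rfl⟩ := hp
  refine ⟨Dir.reflect σ.isSome (if a = 0 then .south else .west), fun d b => ?_⟩
  rw [hv.label_place, CombLabel.isInputOf_comp_reflect, hv.isInputOf_stripLabel_iff hh,
    (Dir.involutive_reflect σ.isSome).eq_iff]

theorem input_kind_of_isInputOf (hp : p ∈ C.region)
    (h : CombLabel.system.IsInputOf (C.label p) d b) : (C.kind p).Input d b := by
  obtain hh | ⟨σ, a, l, hv, hs, rfl⟩ | hf := isHard_or_counter_or_isFill hp
  · obtain ⟨d₀, hd₀⟩ := hh.exists_isInputOf_label_iff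
    obtain ⟨-, rfl, rfl⟩ := (hd₀ d b).1 h
    exact hh.kind_eq ▸ .hard p d
  · rw [hv.label_place_of_notMem hs, CombLabel.isInputOf_comp_reflect] at h
    exact hv.kind_place hs ▸ .counter (CounterTile.input_of_isInputOf h)
  · rw [hf.label_eq] at h
    obtain ⟨hb, hin⟩ := h
    rw [hf.kind_eq]
    cases d <;> obtain rfl := Option.some.inj hb
    case south => exact .fill_south
    case west => exact .fill_west
    all_goals exact absurd hin Bool.false_ne_true

theorem sum_inputWeight_label (hp : p ∈ C.region) (h0 : p ≠ 0) :
    ∑ d, CombLabel.system.inputWeight (C.label p) d = 2 := by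
  obtain hh | ⟨σ, a, l, hv, hs, rfl⟩ | hf := isHard_or_counter_or_isFill hp
  · obtain ⟨d₀, hd₀⟩ := hh.exists_isInputOf_label_iff
    rw [Finset.sum_eq_single d₀]
    · exact ((hd₀ d₀ _).2 ⟨h0, rfl, rfl⟩).inputWeight
    · intro d _ hd
      by_contra hne
      obtain ⟨b, hb⟩ := LabelSystem.exists_isInputOf_of_inputWeight_ne_zero hne
      exact hd ((hd₀ d b).1 hb).2.1
    · exact fun h => absurd (Finset.mem_univ _) h
  · rw [hv.label_place_of_notMem hs]
    simp only [CombLabel.inputWeight_comp_reflect]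
    rw [Dir.sum_comp_reflect, CounterTile.sum_inputWeight_label]
  · rw [hf.label_eq, Dir.sum_univ]
    simp [LabelSystem.inputWeight, fillLabel, CombLabel.system, CombLabel.IsInput,
      CombLabel.weight, Dir.isLow]

theorem exists_ne_one_or_exists_ne {ι : Type*} {D : Finset ι} {f : ι → ℕ}
    (h : 2 ≤ ∑ d ∈ D, f d) : (∃ d ∈ D, f d ≠ 1) ∨ ∃ d ∈ D, ∃ e ∈ D, d ≠ e := by
  by_contra! hD
  rw [Finset.sum_congr rfl hD.1, ← Finset.card_eq_sum_ones] at h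
  obtain ⟨d, hd, e, he, hne⟩ := Finset.one_lt_card.1 h
  exact hne (hD.2 d hd e he)

theorem isFill_of_kind_eq_fill (hp : p ∈ C.region) (hk : C.kind p = .fill) : C.IsFill p := by
  obtain hh | ⟨σ, a, l, hv, hs, rfl⟩ | hf := isHard_or_counter_or_isFill hp
  · cases hh.kind_eq ▸ hk
  · cases hv.kind_place hs ▸ hk
  · exact hf

variable {D : Finset Dir}

theorem isFill_of_supplied (hr : C.IsFill r)
    (hD : ∀ d ∈ D, ∃ b, CombLabel.system.IsInputOf (C.label r) d b ∧ p + d.vec ∈ C.region ∧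
      C.label (p + d.vec) d.opp = some b)
    (hsum : 2 ≤ ∑ d ∈ D, CombLabel.system.inputWeight (C.label r) d) : C.IsFill p := by
  have hinput {d b} (h : CombLabel.system.IsInputOf (C.label r) d b) : Kind.fill.Input d b :=
    hr.kind_eq ▸ input_kind_of_isInputOf hr.mem_region h
  obtain ⟨d, hd, hne⟩ | ⟨d, hd, e, he, hne⟩ := exists_ne_one_or_exists_ne hsum
  · obtain ⟨b, hb, -⟩ := hD d hd
    rw [hb.inputWeight] at hne
    cases hinput hb <;> exact absurd rfl hne
  · obtain ⟨b, hb, hmem, hlabel⟩ := hD d hd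
    obtain ⟨c, hc, hmem', hlabel'⟩ := hD e he
    cases hinput hb <;> cases hinput hc
    · exact absurd rfl hne
    · exact isFill_of_label_eq_fill hmem hlabel hmem' hlabel'
    · exact isFill_of_label_eq_fill hmem' hlabel' hmem hlabel
    · exact absurd rfl hne

theorem isInputOf_label_of_supplied (hr : r ∈ C.region) (hk : C.kind r ≠ .fill)
    (hb : CombLabel.system.IsInputOf (C.label r) d b) (hmem : p + d.vec ∈ C.region)
    (hlabel : C.label (p + d.vec) d.opp = some b) :
    p ∈ C.region ∧ CombLabel.system.IsInputOf (C.label p) d b := by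
  have h := matched_of_label_eq hmem hlabel
    (Or.inr fun o => (input_kind_of_isInputOf hr hb).ne_fill hk o)
  have hp := h.mem_region
  have hp' := h.label_eq
  rw [Dir.add_vec_add_opp_vec] at hp hp'
  rw [Dir.opp_opp] at hp'
  exact ⟨hp, hp', hb.2⟩

theorem mem_region_and_label_eq_of_supplied (hr : r ∈ C.region)
    (hD : ∀ d ∈ D, ∃ b, CombLabel.system.IsInputOf (C.label r) d b ∧ p + d.vec ∈ C.region ∧
      C.label (p + d.vec) d.opp = some b)
    (hsum : 2 ≤ ∑ d ∈ D, CombLabel.system.inputWeight (C.label r) d) :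
    p ∈ C.region ∧ C.label p = C.label r := by
  by_cases hk : C.kind r = .fill
  · have hr' := isFill_of_kind_eq_fill hr hk
    have hp := isFill_of_supplied hr' hD hsum
    exact ⟨hp.mem_region, hp.label_eq.trans hr'.label_eq.symm⟩
  have hinput : ∀ d ∈ D, ∃ b, CombLabel.system.IsInputOf (C.label r) d b ∧ p ∈ C.region ∧
      CombLabel.system.IsInputOf (C.label p) d b := fun d hd => by
    obtain ⟨b, hb, hmem, hlabel⟩ := hD d hd
    exact ⟨b, hb, isInputOf_label_of_supplied hr hk hb hmem hlabel⟩
  suffices p ∈ C.region ∧ C.kind p = C.kind r from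
    ⟨this.1, by rw [label_eq_kindLabel this.1, label_eq_kindLabel hr, this.2]⟩
  obtain ⟨d, hd, hne⟩ | ⟨d, hd, e, he, hne⟩ := exists_ne_one_or_exists_ne hsum
  · obtain ⟨b, hb, hp, hb'⟩ := hinput d hd
    rw [hb.inputWeight] at hne
    exact ⟨hp, (input_kind_of_isInputOf hp hb').eq_of_weight_ne_one
      (input_kind_of_isInputOf hr hb) hne⟩
  · obtain ⟨b, hb, hp, hb'⟩ := hinput d hd
    obtain ⟨c, hc, -, hc'⟩ := hinput e he
    exact ⟨hp, (input_kind_of_isInputOf hp hb').eq_of_ne hne (input_kind_of_isInputOf hp hc')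
      (input_kind_of_isInputOf hr hb) (input_kind_of_isInputOf hr hc)⟩

theorem inStrip_start : C.InStrip none 0 0 where
  mem_strips := Finset.none_mem_insertNone
  lt_width := lt_of_lt_of_le two_pos C.two_le
  firstLine_le := le_rfl
  lt_n := (lt_of_lt_of_le two_pos C.two_le).trans_le C.h_le

theorem isHard_zero : C.IsHard 0 :=
  ⟨none, 0, 0, inStrip_start, C.pair_firstLine_mem_hardPairs none, rfl⟩

variable (C) in
/-- The assembly of the square, starting from the hard-coded tile in the south-west corner. -/
noncomputable def blueprint : Blueprint CombLabel.system 2 where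
  region := C.region
  label := C.label
  start := 0
  start_mem := inStrip_start.place_mem_region
  rank := C.rank
  start_inputs d b hb := by
    obtain ⟨d₀, hd₀⟩ := (isHard_zero (C := C)).exists_isInputOf_label_iff
    exact ((hd₀ d b).1 hb).1 rfl
  supplied p hp d b hb := by
    have h := matched_of_label_eq hp hb.1 (Or.inl hb.2)
    exact ⟨h.mem_region, h.label_eq, h.rank_lt hb.2⟩
  sum_inputWeight p hp h0 := sum_inputWeight_label hp h0
  determined p r hr D hD hsum := mem_region_and_label_eq_of_supplied hr hD hsum

end Determination

section Counting

variable {C : Comb} {σ : Option ℕ} {a l : ℕ} {p q : Point}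

theorem IsHard.mem_region (hp : C.IsHard p) : p ∈ C.region := by
  obtain ⟨σ, a, l, hv, -, rfl⟩ := hp
  exact hv.place_mem_region

theorem isHard_of_mem (hp : p ∈ C.L) : C.IsHard p := by
  obtain ⟨x, y, rfl, hx, hy⟩ := exists_of_mem_region (mem_region.2 (C.mem_square p hp))
  by_cases h : x < C.h
  · refine ⟨none, x, y, ⟨Finset.none_mem_insertNone, h, Nat.zero_le _, hy⟩,
      pair_mem_hardPairs ?_, rfl⟩
    exact Finset.mem_union_right _ (Finset.mem_image.2 ⟨_, hp, rfl⟩)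
  · have hj : C.slab y ∈ C.teeth :=
      Finset.mem_insert_of_mem (Finset.mem_image.2 ⟨_, hp, rfl⟩)
    refine ⟨_, _, _, inStrip_tooth (not_lt.1 h) hx hy hj, pair_mem_hardPairs ?_,
      (place_tooth hy).symm⟩
    exact Finset.mem_union_right _ (Finset.mem_image.2 ⟨_, Finset.mem_filter.2 ⟨hp, rfl⟩, rfl⟩)

theorem eq_of_kind_eq_hard (hq : q ∈ C.region) (hk : C.kind q = .hard p) : q = p := by
  obtain hh | ⟨σ, a, l, hv, hs, rfl⟩ | hf := isHard_or_counter_or_isFill hq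
  · exact Kind.hard.inj (hh.kind_eq ▸ hk)
  · cases hv.kind_place hs ▸ hk
  · cases hf.kind_eq ▸ hk

theorem IsHard.eq_of_label_eq (hp : C.IsHard p) (hq : q ∈ C.region)
    (h : C.label q = C.label p) : q = p := by
  obtain ⟨d₀, hd₀⟩ := hp.exists_isInputOf_label_iff
  by_cases hp0 : p = 0
  · by_contra hqp
    have hsum := sum_inputWeight_label hq (hp0 ▸ hqp)
    obtain ⟨d, -, hd⟩ := Finset.exists_ne_zero_of_sum_ne_zero (hsum ▸ two_ne_zero)
    obtain ⟨b, hb⟩ := LabelSystem.exists_isInputOf_of_inputWeight_ne_zero hd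
    exact ((hd₀ d b).1 (h ▸ hb)).1 hp0
  · have hin : CombLabel.system.IsInputOf (C.label p) d₀ (.enter p) := (hd₀ _ _).2 ⟨hp0, rfl, rfl⟩
    have hin' := input_kind_of_isInputOf hq (h ▸ hin)
    exact eq_of_kind_eq_hard hq ((Kind.Input.hard p d₀).eq_of_weight_ne_one hin'
      (by simp [CombLabel.weight])).symm

theorem InStrip.isHard_entry (hv : C.InStrip σ a l) (hs : C.pair l ∉ C.hardPairs σ) :
    C.IsHard (C.entry σ (C.pair l)) := by
  have hP := pair_lt_pair_last hv.lt_n hs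
  obtain ⟨hmem, hlt⟩ := nextHard_spec (σ := σ) hP
  have hle := nextHard_le (C.pair_last_mem_hardPairs σ) hP
  have hfirst := hv.firstLine_le
  have hpair : C.pair (2 * C.nextHard σ (C.pair l) - C.n % 2) = C.nextHard σ (C.pair l) := by
    unfold pair at *
    omega
  refine ⟨σ, 0, _, ⟨hv.mem_strips, Nat.zero_lt_of_lt hv.lt_width, ?_, ?_⟩, by rwa [hpair], rfl⟩
  · unfold pair at *
    omega
  · unfold pair at *
    omega

theorem isHard_of_mem_target_kind (hp : p ∈ C.region) (hq : q ∈ (C.kind p).target) :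
    C.IsHard q := by
  obtain hh | ⟨σ, a, l, hv, hs, rfl⟩ | hf := isHard_or_counter_or_isFill hp
  · rw [hh.kind_eq] at hq
    cases hq
    exact hh
  · rw [hv.kind_place hs] at hq
    rw [eq_entry_of_mem_target hq]
    exact hv.isHard_entry hs
  · rw [hf.kind_eq] at hq
    cases hq

variable (C)

theorem card_teeth_le : C.teeth.card ≤ C.L.card + 1 :=
  (Finset.card_insert_le _ _).trans (Nat.add_le_add_right Finset.card_image_le 1)

theorem sum_card_hardLines_le : ∑ σ ∈ C.strips, (C.hardLines σ).card ≤ 5 * (C.L.card + 1) := by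
  have hspine : (C.hardLines none).card ≤ 2 + C.teeth.card + C.L.card := by
    unfold hardLines
    grw [Finset.card_union_le, Finset.card_union_le, Finset.card_le_two, Finset.card_image_le,
      Finset.card_image_le]
  have htooth (j : ℕ) : (C.hardLines (some j)).card ≤
      2 + (C.L.filter fun p => C.slab p.2.toNat = j).card := by
    unfold hardLines
    grw [Finset.card_union_le, Finset.card_le_two, Finset.card_image_le]
  have hpixels : ∑ j ∈ C.teeth, (C.L.filter fun p => C.slab p.2.toNat = j).card = C.L.card :=
    (Finset.card_eq_sum_card_fiberwise fun p hp =>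
      Finset.mem_insert_of_mem (Finset.mem_image_of_mem _ hp)).symm
  have hteeth := C.card_teeth_le
  calc ∑ σ ∈ C.strips, (C.hardLines σ).card
      = (C.hardLines none).card + ∑ j ∈ C.teeth, (C.hardLines (some j)).card := by
        simp [strips, Finset.insertNone]
    _ ≤ (2 + C.teeth.card + C.L.card) +
          ∑ j ∈ C.teeth, (2 + (C.L.filter fun p => C.slab p.2.toNat = j).card) :=
        Nat.add_le_add hspine (Finset.sum_le_sum fun j _ => htooth j)
    _ ≤ 5 * (C.L.card + 1) := by
        rw [Finset.sum_add_distrib, hpixels, Finset.sum_const, smul_eq_mul]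
        omega

theorem card_isHard_le :
    (C.region.filter C.IsHard).card ≤ 5 * (C.L.card + 1) * (2 * (2 * C.h)) := by
  let U : Finset (Σ _ : Option ℕ, ℕ) := C.strips.sigma C.hardLines
  let f : (Σ _ : Option ℕ, ℕ) × ℕ × ℕ → Point := fun x =>
    C.place x.1.1 x.2.2 (2 * C.pair x.1.2 - C.n % 2 + x.2.1)
  have hsub : C.region.filter C.IsHard ⊆
      (U ×ˢ Finset.range 2 ×ˢ Finset.range (2 * C.h)).image f := by
    intro p hp
    obtain ⟨σ, a, l, hv, hh, rfl⟩ := (Finset.mem_filter.1 hp).2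
    obtain ⟨l', hl', hpair⟩ := Finset.mem_image.1 hh
    have hline : 2 * C.pair l' - C.n % 2 + (l - (2 * C.pair l' - C.n % 2)) = l := by
      rw [hpair]
      unfold pair
      omega
    refine Finset.mem_image.2 ⟨(⟨σ, l'⟩, l - (2 * C.pair l' - C.n % 2), a), ?_, by simp [f, hline]⟩
    simp only [Finset.mem_product, Finset.mem_range]
    refine ⟨Finset.mem_sigma.2 ⟨hv.mem_strips, hl'⟩, ?_,
      hv.lt_width.trans_le (C.width_le_two_mul σ)⟩
    rw [hpair]
    unfold pair
    omega
  calc (C.region.filter C.IsHard).card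
      ≤ (U ×ˢ Finset.range 2 ×ˢ Finset.range (2 * C.h)).card :=
        (Finset.card_le_card hsub).trans Finset.card_image_le
    _ = (∑ σ ∈ C.strips, (C.hardLines σ).card) * (2 * (2 * C.h)) := by
        simp only [Finset.card_product, Finset.card_range, U, Finset.card_sigma]
    _ ≤ 5 * (C.L.card + 1) * (2 * (2 * C.h)) := Nat.mul_le_mul_right _ C.sum_card_hardLines_le

theorem card_image_label_le (hL : C.L.Nonempty) :
    (C.region.image C.label).card ≤ 553 * (C.L.card * C.h) := by
  obtain ⟨T, hcard, hT⟩ := Kind.exists_finset_card_le (C.region.filter C.IsHard)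
  have hsub : C.region.image C.label ⊆ T.image C.kindLabel := by
    intro t ht
    obtain ⟨p, hp, rfl⟩ := Finset.mem_image.1 ht
    refine Finset.mem_image.2 ⟨C.kind p, hT _ fun q hq => ?_, (label_eq_kindLabel hp).symm⟩
    have hq := isHard_of_mem_target_kind hp hq
    exact Finset.mem_filter.2 ⟨hq.mem_region, hq⟩
  have hL1 : 1 ≤ C.L.card := hL.card_pos
  have hLh : 1 ≤ C.L.card * C.h := Nat.mul_pos hL1 (two_pos.trans_le C.two_le)
  calc (C.region.image C.label).card
      ≤ 13 * (C.region.filter C.IsHard).card + 33 :=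
        ((Finset.card_le_card hsub).trans Finset.card_image_le).trans hcard
    _ ≤ 13 * (5 * (C.L.card + 1) * (2 * (2 * C.h))) + 33 := by
        gcongr
        exact C.card_isHard_le
    _ ≤ 13 * (5 * (C.L.card + C.L.card) * (2 * (2 * C.h))) + 33 * (C.L.card * C.h) := by
        gcongr
        exact Nat.le_mul_of_pos_right 33 hLh
    _ = 553 * (C.L.card * C.h) := by ring

end Counting

end Comb

end ATAM

theorem theorem2_general :
    ∃ K : ℝ, ∀ (C : Type*) (black white : C) (n : ℕ) (L : Finset (ℤ × ℤ)),
      2 ≤ n → L.Nonempty → (∀ p ∈ L, p ∈ ATAM.square n) →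
        ∃ (S : ATAM.TAS) (color : S.tiles → C),
          S.temp = 2 ∧ S.SinglySeeded ∧
          (S.tiles.card : ℝ) ≤ K * (L.card * Real.logb 2 n) ∧
          S.WeaklySelfAssembles color {black, white} (ATAM.multiPixel black white n L) := by
  refine ⟨1106, fun C black white n L hn hne hL => ?_⟩
  have hlog : 1 ≤ Nat.log 2 n := Nat.log_pos one_lt_two hn
  let B : ATAM.Comb :=
    { n := n
      h := Nat.log 2 n + 1
      L := L
      two_le := Nat.succ_le_succ hlog
      h_le := Nat.log_lt_self 2 (by omega)
      n_le := (Nat.lt_pow_succ_log_self one_lt_two n).le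
      mem_square := hL }
  obtain ⟨S, color, htemp, hseed, hcard, hS⟩ := B.blueprint.exists_weaklySelfAssembles
    (black := black) (white := white) (P := ATAM.multiPixel black white n L) two_pos
    (fun p hp q hq h => (ATAM.Comb.isHard_of_mem hp).eq_of_label_eq hq h ▸ hp)
    (fun _ _ => and_congr_left' (ATAM.Comb.mem_region (C := B)).symm)
  refine ⟨S, color, htemp, hseed, ?_, hS⟩
  have hcard' : S.tiles.card ≤ 553 * (L.card * (Nat.log 2 n + 1)) :=
    hcard.trans (B.card_image_label_le hne)
  have hle : (Nat.log 2 n : ℝ) ≤ Real.logb 2 n := by exact_mod_cast Real.natLog_le_logb n 2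
  have hone : (1 : ℝ) ≤ Nat.log 2 n := by exact_mod_cast hlog
  calc (S.tiles.card : ℝ) ≤ 553 * (L.card * (Nat.log 2 n + 1)) := by exact_mod_cast hcard'
    _ ≤ 553 * (L.card * (2 * Real.logb 2 n)) := by gcongr; linarith
    _ = 1106 * (L.card * Real.logb 2 n) := by ring

theorem theorem2 :
    ∃ K : ℝ, ∀ (C : Type*) (black white : C), black ≠ white →
      ∀ (n : ℕ) (L : Finset (ℤ × ℤ)), 2 ≤ n → L.Nonempty →
        (∀ p ∈ L, p ∈ ATAM.square n) →
        (∀ p ∈ L, ∀ q ∈ L, p ≠ q →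
          ⌈Real.logb 2 n⌉ ≤ |p.1 - q.1| ∨ ⌈Real.logb 2 n⌉ ≤ |p.2 - q.2|) →
        ∃ (S : ATAM.TAS) (color : S.tiles → C),
          S.temp = 2 ∧ S.SinglySeeded ∧
          (S.tiles.card : ℝ) ≤ K * (L.card * Real.logb 2 n) ∧
          S.WeaklySelfAssembles color {black, white} (ATAM.multiPixel black white n L) := by
  obtain ⟨K, hK⟩ := theorem2_general
  exact ⟨K, fun C black white _ n L hn hne hL _ => hK C black white n L hn hne hL⟩
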